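/- Consider a discounted Markov decision process with a finite state set $\mathcal S$, finite nonempty action sets $\mathcal A_i$ ($i\in\mathcal S$), transition probabilities $p_{ij}(a)$, rewards $r_{i,a}\in[0,1]$, discount factor $\gamma\in(0,1)$ and initial distribution $q$ on $\mathcal S$. Let $\mathcal A=\{(i,a): i\in\mathcal S, a\in\mathcal A_i\}$ and assume $|\mathcal A|\ge 2$. A policy is a family $\pi=(\pi_i)_{i\in\mathcal S}$ of probability distributions $\pi_i$ on $\mathcal A_i$; its value is $\bar v^\pi=\mathbb E^\pi\big[\sum_{t\ge1}\gamma^{t-1}r_{i_t,a_t}\mid i_1\sim q\big]$, and $\bar v^*=\sup_\pi\bar v^\pi$. Let $\varepsilon\in(0,1)$, $M=(1-\gamma)^{-1}$, $\varepsilon'=(1-\gamma)\varepsilon/3$, $\mathcal V=[-2M,2M]^{\mathcal S}$, let $\Delta^{\mathcal A}$ be the simplex of probability vectors on $\mathcal A$, and let $$f(v,\mu)=(1-\gamma)\sum_i q_iv_i+\sum_{(i,a)}\mu_{i,a}\Big(\gamma\sum_j p_{ij}(a)v_j-v_i+r_{i,a}\Big),\qquad \mathrm{Gap}(v,\mu)=\max_{\mu'\in\Delta^{\mathcal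 A}}f(v,\mu')-\min_{v'\in\mathcal V}f(v',\mu).$$ Stochastic mirror descent with step sizes $\eta^v,\eta^\mu>0$ and $T$ iterations starts at an arbitrary $v_0\in\mathcal V$ and the uniform $\mu_0\in\Delta^{\mathcal A}$. For $t=1,\dots,T$ it draws $(i,a)\sim\mu_{t-1}$, $j\sim p_{i\cdot}(a)$, $i'\sim q$ and sets $g^v=(1-\gamma)e_{i'}+\gamma e_j-e_i$; independently it draws $(k,b)\in\mathcal A$ uniformly, $l\sim p_{k\cdot}(b)$ and sets $g^\mu=|\mathcal A|\,\big((v_{t-1})_k-\gamma (v_{t-1})_l-r_{k,b}\big)e_{k,b}$; then $v_t$ is the Euclidean projection of $v_{t-1}-\eta^vg^v$ onto $\mathcal V$, and $\mu_t$ is $\mu_{t-1}\circ\exp(-\eta^\mu g^\mu)$ normalized to sum $1$. It returns $(v^\varepsilon,\mu^\varepsilon)=\frac1T\sum_{t=1}^T(v_t,\mu_t)$. There are absolute constants $c_v,c_\mu,c_T,C>0$ such that, for every such process and every such $q$, $\varepsilon$, $v_0$, with $\eta^v=c_v\varepsilon'$, $\eta^\mu=c_\mu\varepsilon' M^{-2}|\mathcal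 A|^{-1}$ and $T=\lceil c_TM^2|\mathcal A|\log|\mathcal A|\,\varepsilon'^{-2}\rceil$ the following hold. 1. The output is an expected $\varepsilon'$-approximate saddle point: $\mathbb E\,\mathrm{Gap}(v^\varepsilon,\mu^\varepsilon)\le\varepsilon'$. 2. There are always a unique probability vector $\lambda^\varepsilon$ on $\mathcal S$ and a unique policy $\pi^\varepsilon$ with $\mu^\varepsilon_{i,a}=\lambda^\varepsilon_i\,\pi^\varepsilon_i(a)$ for all $(i,a)\in\mathcal A$, and $\pi^\varepsilon$ is an expected $\varepsilon$-optimal policy: $\mathbb E\,\bar v^{\pi^\varepsilon}\ge\bar v^*-\varepsilon$. 3. The total number of samples drawn is at most $C\,(1-\gamma)^{-4}|\mathcal A|\,\varepsilon^{-2}\log|\mathcal A|$. -/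

import Mathlib

universe u w

/-- A discounted Markov decision process with finite state set `S` and finite action sets `A i`.
The pair `⟨i, a⟩ : Σ i, A i` is the action `a` taken at the state `i`. -/
structure DMDP (S : Type u) (A : S → Type w) [Fintype S] [∀ i, Fintype (A i)] where
  /-- `P ⟨i, a⟩ j` is the probability of moving to `j` when action `a` is taken at `i`. -/
  P : (Σ i, A i) → stdSimplex ℝ S
  /-- instant rewards -/
  r : (Σ i, A i) → ℝ
  r_mem : ∀ x, r x ∈ Set.Icc (0 : ℝ) 1
  /-- discount factor -/
  γ : ℝ
  γ_mem : γ ∈ Set.Ioo (0 : ℝ) 1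

/-- A randomized (stationary) policy: a probability vector on `A i` for every state `i`. -/
abbrev Policy (S : Type u) (A : S → Type w) [∀ i, Fintype (A i)] : Type (max u w) :=
  ∀ i : S, stdSimplex ℝ (A i)

/-- The box `m · [-1, 1]^S`. -/
def box (S : Type u) (m : ℝ) : Set (S → ℝ) := {v | ∀ i, |v i| ≤ m}

/-- `mu i a = lam i * π i a`, with `lam` a probability vector on states and `π` a policy. -/
def IsDecomposition {S : Type u} {A : S → Type w} [Fintype S] [∀ i, Fintype (A i)]
    (mu : (Σ i, A i) → ℝ) (lam : stdSimplex ℝ S) (π : Policy S A) : Prop :=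
  ∀ (i : S) (a : A i), mu ⟨i, a⟩ = lam i * π i a

/-- The random draws of one iteration of the algorithm, in order:
`(i, a)`, `j`, `i'` for the `v`-gradient, then `(i, a)`, `j` for the `mu`-gradient. -/
abbrev IterSample (S : Type u) (A : S → Type w) : Type (max u w) :=
  (Σ i, A i) × S × S × (Σ i, A i) × S

/-- The list of the individual samples drawn in one iteration. -/
def IterSample.draws {S : Type u} {A : S → Type w} :
    IterSample S A → List ((Σ i, A i) ⊕ S)
  | (x, j, i', y, k) => [Sum.inl x, Sum.inr j, Sum.inr i', Sum.inl y, Sum.inr k]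

/-- The number of samples drawn in a run with transcript `ω`. All draws are counted: those from
the generative model as well as those from the initial distribution, from the current dual
iterate and from the uniform distribution. -/
def sampleCount {S : Type u} {A : S → Type w} {T : ℕ} (ω : Fin T → IterSample S A) : ℕ :=
  ∑ t, (IterSample.draws (ω t)).length

/-- The parameters of the algorithm: the initial state distribution `q`, the initial primal
iterate `v₀`, the domain size `M` (the primal domain is the box of radius `2 * M`) and the two
step sizes. -/
structure SMDParams (S : Type u) [Fintype S] where
  q : stdSimplex ℝ S
  v₀ : S → ℝ
  M : ℝ
  ηv : ℝ
  ημ : ℝ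

namespace DMDP

noncomputable section

variable {S : Type u} {A : S → Type w} [Fintype S] [∀ i, Fintype (A i)]

/-- The total number of state-action pairs. -/
def numPairs (_D : DMDP S A) : ℕ := Fintype.card (Σ i, A i)

/-! ### Values of policies -/

/-- The law of the `t`-th state-action pair (counted from `0`) when the initial state has law `q`
and the policy `π` is followed. -/
def pairLaw (D : DMDP S A) (q : stdSimplex ℝ S) (π : Policy S A) : ℕ → (Σ i, A i) → ℝ
  | 0, x => q x.1 * π x.1 x.2
  | t + 1, x => (∑ y, D.pairLaw q π t y * D.P y x.1) * π x.1 x.2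

/-- The expected discounted cumulative reward of `π` for the initial law `q`. -/
def value (D : DMDP S A) (q : stdSimplex ℝ S) (π : Policy S A) : ℝ :=
  ∑' t : ℕ, D.γ ^ t * ∑ x, D.pairLaw q π t x * D.r x

/-- The optimal expected discounted cumulative reward over all policies. -/
def optValue (D : DMDP S A) (q : stdSimplex ℝ S) : ℝ := ⨆ π : Policy S A, D.value q π

/-! ### The minimax problem -/

/-- The objective `(1 - γ) qᵀ v + muᵀ ((γ P - Î) v + r)`. -/
def objective (D : DMDP S A) (q : stdSimplex ℝ S) (v : S → ℝ) (mu : (Σ i, A i) → ℝ) : ℝ :=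
  (1 - D.γ) * ∑ i, q i * v i + ∑ x, mu x * (D.γ * ∑ j, D.P x j * v j - v x.1 + D.r x)

/-- The duality gap at `(v, mu)` of the problem of minimizing over the box of radius `2 * M` the
maximum over the simplex of the objective. -/
def gap (D : DMDP S A) (q : stdSimplex ℝ S) (M : ℝ) (v : S → ℝ) (mu : (Σ i, A i) → ℝ) : ℝ :=
  sSup ((fun mu' => D.objective q v mu') '' stdSimplex ℝ (Σ i, A i)) -
    sInf ((fun v' => D.objective q v' mu) '' box S (2 * M))

/-! ### Stochastic mirror descent -/

open Classical in
/-- The estimator `(1 - γ) e_{i'} + γ e_j - e_i` of the `v`-gradient. -/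
def gradV (D : DMDP S A) : IterSample S A → S → ℝ
  | (x, j, i', _, _) =>
    (1 - D.γ) • Pi.single i' (1 : ℝ) + D.γ • Pi.single j (1 : ℝ) - Pi.single x.1 (1 : ℝ)

open Classical in
/-- The estimator `|A| (v_i - γ v_j - r_{i,a}) e_{i,a}` of the `mu`-gradient. -/
def gradMu (D : DMDP S A) (v : S → ℝ) : IterSample S A → (Σ i, A i) → ℝ
  | (_, _, _, y, k) => Pi.single y ((D.numPairs : ℝ) * (v y.1 - D.γ * v k - D.r y))

/-- One iteration: a Euclidean gradient step followed by the Euclidean projection onto the box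
(coordinatewise clamping), and a multiplicative step followed by the Kullback-Leibler projection
onto the simplex (normalization). Both gradients are taken at the old iterate. -/
def step (D : DMDP S A) (p : SMDParams S) (z : (S → ℝ) × ((Σ i, A i) → ℝ))
    (s : IterSample S A) : (S → ℝ) × ((Σ i, A i) → ℝ) :=
  (fun i => max (-(2 * p.M)) (min (2 * p.M) (z.1 i - p.ηv * D.gradV s i)),
   fun x => z.2 x * Real.exp (-(p.ημ * D.gradMu z.1 s x)) /
     ∑ y, z.2 y * Real.exp (-(p.ημ * D.gradMu z.1 s y)))

/-- The iterate `(v_n, mu_n)` as a function of the draws of the first `n` iterations, started at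
`v₀` and the uniform distribution. -/
def iterate (D : DMDP S A) (p : SMDParams S) :
    (n : ℕ) → (Fin n → IterSample S A) → (S → ℝ) × ((Σ i, A i) → ℝ)
  | 0, _ => (p.v₀, fun _ => (D.numPairs : ℝ)⁻¹)
  | n + 1, ω => D.step p (D.iterate p n (Fin.init ω)) (ω (Fin.last n))

/-- The probability of the draws `((i, a), j, i', (k, b), l)` in an iteration that starts at the
dual iterate `mu`: `(i, a) ∼ mu`, `j ∼ P (i, a)`, `i' ∼ q`, `(k, b)` uniform, `l ∼ P (k, b)`. -/
def sampleProb (D : DMDP S A) (p : SMDParams S) (mu : (Σ i, A i) → ℝ) : IterSample S A → ℝ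
  | (x, j, i', y, k) => mu x * D.P x j * p.q i' * (D.numPairs : ℝ)⁻¹ * D.P y k

/-- The probability that the draws of a run of `T` iterations are `ω`. -/
def runLaw (D : DMDP S A) (p : SMDParams S) {T : ℕ} (ω : Fin T → IterSample S A) : ℝ :=
  ∏ t : Fin T, D.sampleProb p (D.iterate p t (Fin.take t t.isLt.le ω)).2 (ω t)

/-- Expectation over the draws of a run of `T` iterations. -/
def runExpect (D : DMDP S A) (p : SMDParams S) {T : ℕ}
    (f : (Fin T → IterSample S A) → ℝ) : ℝ :=
  ∑ ω, D.runLaw p ω * f ω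

/-- The output `(1 / T) ∑_{t = 1}^{T} (v_t, mu_t)` of a run of `T` iterations. -/
def output (D : DMDP S A) (p : SMDParams S) {T : ℕ} (ω : Fin T → IterSample S A) :
    (S → ℝ) × ((Σ i, A i) → ℝ) :=
  (T : ℝ)⁻¹ • ∑ t : Fin T, D.iterate p (t + 1) (Fin.take (t + 1) t.isLt ω)

/-! ### `runLaw` is a probability distribution -/

lemma iterate_mem [Nonempty (Σ i, A i)] (D : DMDP S A) (p : SMDParams S) :
    ∀ (n : ℕ) (ω : Fin n → IterSample S A),
      (∀ x, 0 < (D.iterate p n ω).2 x) ∧ ∑ x, (D.iterate p n ω).2 x = 1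
  | 0, _ => by
    have h : (0 : ℝ) < D.numPairs :=
      Nat.cast_pos.2 (Fintype.card_pos : 0 < Fintype.card (Σ i, A i))
    refine ⟨fun x => ?_, ?_⟩
    · simpa only [iterate] using inv_pos.2 h
    · simp only [iterate, Finset.sum_const, Finset.card_univ, nsmul_eq_mul]
      exact mul_inv_cancel₀ h.ne'
  | n + 1, ω => by
    obtain ⟨h1, -⟩ := iterate_mem D p n (Fin.init ω)
    have hpos : ∀ y, 0 < (D.iterate p n (Fin.init ω)).2 y * Real.exp
        (-(p.ημ * D.gradMu (D.iterate p n (Fin.init ω)).1 (ω (Fin.last n)) y)) :=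
      fun y => mul_pos (h1 y) (Real.exp_pos _)
    have hs := Finset.sum_pos (fun y (_ : y ∈ Finset.univ) => hpos y) Finset.univ_nonempty
    refine ⟨fun x => div_pos (hpos x) hs, ?_⟩
    simp only [iterate, step]
    rw [← Finset.sum_div]
    exact div_self hs.ne'

lemma sum_sampleProb [Nonempty (Σ i, A i)] (D : DMDP S A) (p : SMDParams S)
    (mu : (Σ i, A i) → ℝ) (h : ∑ x, mu x = 1) : ∑ s, D.sampleProb p mu s = 1 := by
  have hN : (D.numPairs : ℝ) ≠ 0 := Nat.cast_ne_zero.2 Fintype.card_ne_zero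
  have hP : ∀ x, ∑ j, D.P x j = 1 := fun x => (D.P x).2.2
  have hq : ∑ j, p.q j = 1 := p.q.2.2
  simp only [Fintype.sum_prod_type, sampleProb, ← Finset.mul_sum, hP]
  simp only [← Finset.sum_mul, ← Finset.mul_sum, hP, hq, h, mul_one, Finset.sum_const,
    Finset.card_univ, nsmul_eq_mul, one_mul]
  exact inv_mul_cancel₀ hN

theorem runLaw_nonneg [Nonempty (Σ i, A i)] (D : DMDP S A) (p : SMDParams S) {T : ℕ}
    (ω : Fin T → IterSample S A) : 0 ≤ D.runLaw p ω := by
  refine Finset.prod_nonneg fun t _ => ?_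
  have h1 := fun x => ((iterate_mem D p t (Fin.take t t.isLt.le ω)).1 x).le
  obtain ⟨x, j, i', y, k⟩ := ω t
  have h2 : 0 ≤ D.P x j := (D.P x).2.1 j
  have h3 : 0 ≤ D.P y k := (D.P y).2.1 k
  have h4 : 0 ≤ p.q i' := p.q.2.1 i'
  have h5 := h1 x
  simp only [sampleProb]
  positivity

theorem sum_runLaw [Nonempty (Σ i, A i)] (D : DMDP S A) (p : SMDParams S) :
    ∀ T : ℕ, ∑ ω : Fin T → IterSample S A, D.runLaw p ω = 1
  | 0 => by simp [runLaw]
  | T + 1 => by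
    have key : ∀ ω : Fin (T + 1) → IterSample S A, D.runLaw p ω =
        D.runLaw p (Fin.init ω) * D.sampleProb p (D.iterate p T (Fin.init ω)).2
          (ω (Fin.last T)) := by
      intro ω
      rw [runLaw, Fin.prod_univ_castSucc]
      rfl
    rw [← (Fin.snocEquiv (fun _ : Fin (T + 1) => IterSample S A)).sum_comp,
      Fintype.sum_prod_type_right, ← sum_runLaw D p T]
    refine Finset.sum_congr rfl fun ω _ => ?_
    have hi : ∀ s, Fin.init ((Fin.snocEquiv fun _ : Fin (T + 1) => IterSample S A) (s, ω)) = ω :=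
      fun s => Fin.init_snoc (α := fun _ : Fin (T + 1) => IterSample S A) s ω
    simp only [key, hi, Fin.snocEquiv_apply, Fin.snoc_last]
    rw [← Finset.mul_sum, sum_sampleProb D p _ (iterate_mem D p T ω).2, mul_one]

end

end DMDP

namespace DMDP

noncomputable section

/-- Averaging a function of state-action pairs over the actions chosen by a policy. -/
def policyMean {S : Type u} {A : S → Type w} [∀ i, Fintype (A i)] (π : Policy S A)
    (h : (Σ i, A i) → ℝ) (i : S) : ℝ :=
  ∑ a, π i a * h ⟨i, a⟩

lemma policyMean_fst {S : Type u} {A : S → Type w} [∀ i, Fintype (A i)] (π : Policy S A)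
    (w : S → ℝ) (i : S) :
    policyMean π (fun x => w x.1) i = w i := by
  have h : ∑ a, π i a = 1 := (π i).2.2
  simp only [policyMean, ← Finset.sum_mul, h, one_mul]

variable {S : Type u} {A : S → Type w} [Fintype S] [∀ i, Fintype (A i)]

/-! ### Occupation measures and value vectors of policies -/

lemma pairLaw_nonneg (D : DMDP S A) (q : stdSimplex ℝ S) (π : Policy S A) :
    ∀ (t : ℕ) (x : Σ i, A i), 0 ≤ D.pairLaw q π t x
  | 0, x => mul_nonneg (q.2.1 _) ((π x.1).2.1 _)
  | t + 1, x => mul_nonneg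
      (Finset.sum_nonneg fun y _ => mul_nonneg (pairLaw_nonneg D q π t y) ((D.P y).2.1 _))
      ((π x.1).2.1 _)

lemma pairLaw_eq_mul (D : DMDP S A) (q : stdSimplex ℝ S) (π : Policy S A) (t : ℕ) :
    ∃ c : S → ℝ, ∀ x, D.pairLaw q π t x = c x.1 * π x.1 x.2 := by
  cases t with
  | zero => exact ⟨fun i => q i, fun x => rfl⟩
  | succ t => exact ⟨fun i => ∑ y, D.pairLaw q π t y * D.P y i, fun x => rfl⟩

lemma sum_mul_policy (π : Policy S A) (c : S → ℝ) (h : (Σ i, A i) → ℝ) :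
    ∑ x : Σ i, A i, c x.1 * π x.1 x.2 * h x = ∑ i, c i * policyMean π h i := by
  rw [Fintype.sum_sigma]
  refine Finset.sum_congr rfl fun i _ => ?_
  rw [policyMean, Finset.mul_sum]
  exact Finset.sum_congr rfl fun a _ => by ring

lemma sum_pairLaw_policyMean (D : DMDP S A) (q : stdSimplex ℝ S) (π : Policy S A) (t : ℕ)
    (h : (Σ i, A i) → ℝ) :
    ∑ x, D.pairLaw q π t x * policyMean π h x.1 = ∑ x, D.pairLaw q π t x * h x := by
  obtain ⟨c, hc⟩ := D.pairLaw_eq_mul q π t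
  simp only [hc]
  rw [sum_mul_policy π c h, sum_mul_policy π c (fun x => policyMean π h x.1)]
  simp only [policyMean_fst]

lemma sum_pairLaw_zero (D : DMDP S A) (q : stdSimplex ℝ S) (π : Policy S A) (w : S → ℝ) :
    ∑ x, D.pairLaw q π 0 x * w x.1 = ∑ i, q i * w i := by
  simp only [pairLaw]
  rw [sum_mul_policy π (fun i => q i) (fun x => w x.1)]
  simp only [policyMean_fst]

lemma sum_pairLaw_succ (D : DMDP S A) (q : stdSimplex ℝ S) (π : Policy S A) (t : ℕ)
    (w : S → ℝ) :
    ∑ x, D.pairLaw q π (t + 1) x * w x.1 =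
      ∑ x, D.pairLaw q π t x * ∑ j, D.P x j * w j := by
  simp only [pairLaw]
  rw [sum_mul_policy π (fun i => ∑ y, D.pairLaw q π t y * D.P y i) (fun x => w x.1)]
  simp only [policyMean_fst, Finset.sum_mul, Finset.mul_sum]
  rw [Finset.sum_comm]
  exact Finset.sum_congr rfl fun i _ => Finset.sum_congr rfl fun a _ => by ring

lemma sum_pairLaw (D : DMDP S A) (q : stdSimplex ℝ S) (π : Policy S A) (t : ℕ) :
    ∑ x, D.pairLaw q π t x = 1 := by
  induction t with
  | zero =>
    have h : ∑ i, q i = 1 := q.2.2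
    simpa [h] using D.sum_pairLaw_zero q π (fun _ => 1)
  | succ t ih =>
    have h : ∀ x, ∑ j, D.P x j = 1 := fun x => (D.P x).2.2
    simpa [h, ih] using D.sum_pairLaw_succ q π t (fun _ => 1)

lemma abs_sum_mul_le {ι : Type*} [Fintype ι] {p h : ι → ℝ} {B : ℝ} (hp : ∀ x, 0 ≤ p x)
    (hs : ∑ x, p x = 1) (hB : ∀ x, |h x| ≤ B) : |∑ x, p x * h x| ≤ B :=
  calc |∑ x, p x * h x| ≤ ∑ x, |p x * h x| := Finset.abs_sum_le_sum_abs _ _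
    _ ≤ ∑ x, p x * B := Finset.sum_le_sum fun x _ => by
        rw [abs_mul, abs_of_nonneg (hp x)]
        exact mul_le_mul_of_nonneg_left (hB x) (hp x)
    _ = B := by rw [← Finset.sum_mul, hs, one_mul]

lemma summable_discounted {γ B : ℝ} (hγ : γ ∈ Set.Ioo (0 : ℝ) 1) {a : ℕ → ℝ}
    (ha : ∀ t, |a t| ≤ B) : Summable fun t => γ ^ t * a t := by
  refine Summable.of_norm_bounded ((summable_geometric_of_lt_one hγ.1.le hγ.2).mul_right B)
    fun t => ?_
  rw [Real.norm_eq_abs, abs_mul, abs_of_nonneg (pow_nonneg hγ.1.le t)]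
  exact mul_le_mul_of_nonneg_left (ha t) (pow_nonneg hγ.1.le t)

lemma tsum_discounted_telescope {γ B : ℝ} (hγ : γ ∈ Set.Ioo (0 : ℝ) 1) {a : ℕ → ℝ}
    (ha : ∀ t, |a t| ≤ B) : ∑' t, γ ^ t * (γ * a (t + 1) - a t) = -a 0 := by
  have h1 := summable_discounted hγ ha
  have h2 : Summable fun t => γ ^ (t + 1) * a (t + 1) := (summable_nat_add_iff 1).2 h1
  have h3 : ∀ t, γ ^ t * (γ * a (t + 1) - a t) = γ ^ (t + 1) * a (t + 1) - γ ^ t * a t :=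
    fun t => by ring
  simp only [h3]
  rw [h2.tsum_sub h1, h1.tsum_eq_zero_add]
  simp

/-- The normalized discounted occupation measure of a policy. -/
def occupation (D : DMDP S A) (q : stdSimplex ℝ S) (π : Policy S A) (x : Σ i, A i) : ℝ :=
  (1 - D.γ) * ∑' t, D.γ ^ t * D.pairLaw q π t x

lemma pairLaw_le_one (D : DMDP S A) (q : stdSimplex ℝ S) (π : Policy S A) (t : ℕ)
    (x : Σ i, A i) : |D.pairLaw q π t x| ≤ 1 := by
  rw [abs_of_nonneg (D.pairLaw_nonneg q π t x), ← D.sum_pairLaw q π t]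
  exact Finset.single_le_sum (fun y _ => D.pairLaw_nonneg q π t y) (Finset.mem_univ x)

lemma sum_occupation_mul (D : DMDP S A) (q : stdSimplex ℝ S) (π : Policy S A)
    (h : (Σ i, A i) → ℝ) :
    ∑ x, D.occupation q π x * h x =
      (1 - D.γ) * ∑' t, D.γ ^ t * ∑ x, D.pairLaw q π t x * h x := by
  simp only [occupation, mul_assoc, ← Finset.mul_sum]
  congr 1
  have hs : ∀ x, Summable fun t => D.γ ^ t * D.pairLaw q π t x * h x := fun x =>
    (summable_discounted D.γ_mem fun t => D.pairLaw_le_one q π t x).mul_right _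
  simp only [← tsum_mul_right, Finset.mul_sum, ← mul_assoc]
  rw [Summable.tsum_finsetSum fun x _ => hs x]

lemma occupation_mem (D : DMDP S A) (q : stdSimplex ℝ S) (π : Policy S A) :
    D.occupation q π ∈ stdSimplex ℝ (Σ i, A i) := by
  have hγ := D.γ_mem
  refine ⟨fun x => mul_nonneg (sub_nonneg.2 hγ.2.le) (tsum_nonneg fun t =>
    mul_nonneg (pow_nonneg hγ.1.le t) (D.pairLaw_nonneg q π t x)), ?_⟩
  have h := D.sum_occupation_mul q π (fun _ => 1)
  simp only [mul_one, D.sum_pairLaw, tsum_geometric_of_lt_one hγ.1.le hγ.2] at h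
  rw [h, mul_inv_cancel₀ (sub_pos.2 hγ.2).ne']

lemma objective_occupation (D : DMDP S A) (q : stdSimplex ℝ S) (π : Policy S A) (v : S → ℝ) :
    D.objective q v (D.occupation q π) = (1 - D.γ) * D.value q π := by
  have hγ := D.γ_mem
  obtain ⟨B, hB⟩ : ∃ B, ∀ i, |v i| ≤ B := by
    obtain ⟨B, hB⟩ := (Set.finite_range fun i => |v i|).bddAbove
    exact ⟨B, fun i => hB ⟨i, rfl⟩⟩
  let a : ℕ → ℝ := fun t => ∑ x, D.pairLaw q π t x * v x.1
  have ha : ∀ t, |a t| ≤ B := fun t =>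
    abs_sum_mul_le (D.pairLaw_nonneg q π t) (D.sum_pairLaw q π t) fun x => hB x.1
  have ha' : ∀ t, |D.γ * a (t + 1) - a t| ≤ B + B := fun t => by
    have h1 : |D.γ * a (t + 1)| ≤ B := by
      rw [abs_mul, abs_of_pos hγ.1]
      exact (mul_le_of_le_one_left (abs_nonneg _) hγ.2.le).trans (ha _)
    exact (abs_sub _ _).trans (add_le_add h1 (ha t))
  have hr : ∀ t, |∑ x, D.pairLaw q π t x * D.r x| ≤ 1 := fun t =>
    abs_sum_mul_le (D.pairLaw_nonneg q π t) (D.sum_pairLaw q π t) fun x =>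
      abs_le.2 ⟨by linarith [(D.r_mem x).1], (D.r_mem x).2⟩
  have hE : ∀ t, ∑ x, D.pairLaw q π t x * (D.γ * ∑ j, D.P x j * v j - v x.1 + D.r x) =
      (D.γ * a (t + 1) - a t) + ∑ x, D.pairLaw q π t x * D.r x := fun t => by
    simp only [a, D.sum_pairLaw_succ, mul_add, mul_sub, Finset.sum_add_distrib,
      Finset.sum_sub_distrib]
    rw [Finset.mul_sum]
    congr 2
    exact Finset.sum_congr rfl fun x _ => by ring
  rw [objective, D.sum_occupation_mul]
  simp only [hE, mul_add (D.γ ^ _)]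
  rw [(summable_discounted hγ ha').tsum_add (summable_discounted hγ hr),
    tsum_discounted_telescope hγ ha, ← D.sum_pairLaw_zero q π v, value]
  simp only [a]
  ring

/-- The expected reward collected after `t` steps, as a function of the initial state. -/
def rewardAfter (D : DMDP S A) (π : Policy S A) : ℕ → S → ℝ
  | 0 => policyMean π D.r
  | t + 1 => policyMean π fun x => ∑ j, D.P x j * D.rewardAfter π t j

/-- The value of a policy, as a function of the initial state. -/
def valueVec (D : DMDP S A) (π : Policy S A) (i : S) : ℝ :=
  ∑' t, D.γ ^ t * D.rewardAfter π t i

lemma abs_rewardAfter_le (D : DMDP S A) (π : Policy S A) :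
    ∀ (t : ℕ) (i : S), |D.rewardAfter π t i| ≤ 1
  | 0, i => abs_sum_mul_le (π i).2.1 (π i).2.2 fun a =>
      abs_le.2 ⟨by linarith [(D.r_mem ⟨i, a⟩).1], (D.r_mem ⟨i, a⟩).2⟩
  | t + 1, i => abs_sum_mul_le (π i).2.1 (π i).2.2 fun a =>
      abs_sum_mul_le (D.P ⟨i, a⟩).2.1 (D.P ⟨i, a⟩).2.2 fun j => abs_rewardAfter_le D π t j

lemma valueVec_mem (D : DMDP S A) (π : Policy S A) : D.valueVec π ∈ box S (1 - D.γ)⁻¹ := by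
  have hγ := D.γ_mem
  intro i
  rw [← Real.norm_eq_abs, valueVec]
  refine tsum_of_norm_bounded (hasSum_geometric_of_lt_one hγ.1.le hγ.2) fun t => ?_
  rw [Real.norm_eq_abs, abs_mul, abs_of_nonneg (pow_nonneg hγ.1.le t)]
  exact mul_le_of_le_one_right (pow_nonneg hγ.1.le t) (D.abs_rewardAfter_le π t i)

lemma valueVec_eq (D : DMDP S A) (π : Policy S A) (i : S) :
    policyMean π (fun x => D.γ * ∑ j, D.P x j * D.valueVec π j - D.valueVec π x.1 + D.r x) i
      = 0 := by
  have hγ := D.γ_mem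
  have hs : ∀ i, Summable fun t => D.γ ^ t * D.rewardAfter π t i := fun i =>
    summable_discounted hγ fun t => D.abs_rewardAfter_le π t i
  have h1 : D.valueVec π i = policyMean π D.r i +
      policyMean π (fun x => D.γ * ∑ j, D.P x j * D.valueVec π j) i := by
    rw [valueVec, (hs i).tsum_eq_zero_add]
    simp only [rewardAfter, pow_zero, one_mul]
    congr 1
    have h2 : ∀ t, D.γ ^ (t + 1) * policyMean π (fun x => ∑ j, D.P x j * D.rewardAfter π t j) i =
        ∑ a, ∑ j, π i a * D.γ * D.P ⟨i, a⟩ j * (D.γ ^ t * D.rewardAfter π t j) := fun t => by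
      simp only [policyMean, Finset.mul_sum]
      exact Finset.sum_congr rfl fun a _ => Finset.sum_congr rfl fun j _ => by ring
    simp only [h2]
    rw [Summable.tsum_finsetSum fun a _ => summable_sum fun j _ => (hs j).mul_left _]
    simp only [policyMean]
    refine Finset.sum_congr rfl fun a _ => ?_
    rw [Summable.tsum_finsetSum fun j _ => (hs j).mul_left _]
    simp only [Finset.mul_sum, tsum_mul_left, valueVec]
    exact Finset.sum_congr rfl fun j _ => by ring
  have h3 := policyMean_fst π (D.valueVec π) i
  simp only [policyMean, mul_add, mul_sub, Finset.sum_add_distrib, Finset.sum_sub_distrib]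
    at h1 h3 ⊢
  linarith

lemma sum_valueVec (D : DMDP S A) (q : stdSimplex ℝ S) (π : Policy S A) :
    ∑ i, q i * D.valueVec π i = D.value q π := by
  have hγ := D.γ_mem
  have hs : ∀ i, Summable fun t => D.γ ^ t * D.rewardAfter π t i := fun i =>
    summable_discounted hγ fun t => D.abs_rewardAfter_le π t i
  have h1 : ∀ s t, ∑ x, D.pairLaw q π (s + t) x * D.rewardAfter π 0 x.1 =
      ∑ x, D.pairLaw q π s x * D.rewardAfter π t x.1 := by
    intro s t
    induction t generalizing s with
    | zero => rfl
    | succ t ih =>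
      rw [show s + (t + 1) = s + 1 + t by ring, ih, D.sum_pairLaw_succ]
      simp only [rewardAfter]
      rw [D.sum_pairLaw_policyMean]
  have h2 : ∀ t, ∑ x, D.pairLaw q π t x * D.r x = ∑ i, q i * D.rewardAfter π t i := fun t => by
    rw [← D.sum_pairLaw_zero q π, ← h1 0 t, zero_add]
    exact (D.sum_pairLaw_policyMean q π t D.r).symm
  simp only [value, h2, valueVec, Finset.mul_sum, ← tsum_mul_left]
  rw [Summable.tsum_finsetSum fun i _ =>
    ((hs i).mul_left (q i)).congr fun t => by ring]
  exact Finset.sum_congr rfl fun i _ => tsum_congr fun t => by ring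

lemma objective_valueVec (D : DMDP S A) (q : stdSimplex ℝ S) {mu : (Σ i, A i) → ℝ}
    {lam : stdSimplex ℝ S} {π : Policy S A} (h : IsDecomposition mu lam π) :
    D.objective q (D.valueVec π) mu = (1 - D.γ) * D.value q π := by
  have h1 : ∀ x : Σ i, A i, mu x = lam x.1 * π x.1 x.2 := fun x => h x.1 x.2
  simp only [objective, h1]
  rw [sum_mul_policy π (fun i => lam i) (fun x =>
    D.γ * ∑ j, D.P x j * D.valueVec π j - D.valueVec π x.1 + D.r x), D.sum_valueVec]
  simp only [D.valueVec_eq, mul_zero, Finset.sum_const_zero, add_zero]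

/-! ### Boundedness of the objective, and the duality gap -/

lemma abs_residual_le (D : DMDP S A) {M : ℝ} (hM : 1 ≤ M) {v : S → ℝ}
    (hv : v ∈ box S (2 * M)) (x : Σ i, A i) {y : ℝ} (hy : |y| ≤ 2 * M) :
    |D.γ * y - v x.1 + D.r x| ≤ 5 * M := by
  have hγ := D.γ_mem
  have h1 := abs_le.1 (hv x.1)
  have h2 := D.r_mem x
  have h3 : |D.γ * y| ≤ 2 * M := by
    rw [abs_mul, abs_of_pos hγ.1]
    exact (mul_le_of_le_one_left (abs_nonneg _) hγ.2.le).trans hy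
  have h4 := abs_le.1 h3
  exact abs_le.2 ⟨by linarith [h2.1], by linarith [h2.2]⟩

lemma abs_objective_le (D : DMDP S A) (q : stdSimplex ℝ S) {M : ℝ} (hM : 1 ≤ M) {v : S → ℝ}
    (hv : v ∈ box S (2 * M)) {mu : (Σ i, A i) → ℝ} (hmu : mu ∈ stdSimplex ℝ (Σ i, A i)) :
    |D.objective q v mu| ≤ 7 * M := by
  have hγ := D.γ_mem
  have h1 : |∑ i, q i * v i| ≤ 2 * M := abs_sum_mul_le q.2.1 q.2.2 hv
  have h2 : |∑ x, mu x * (D.γ * ∑ j, D.P x j * v j - v x.1 + D.r x)| ≤ 5 * M :=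
    abs_sum_mul_le hmu.1 hmu.2 fun x => D.abs_residual_le hM hv x
      (abs_sum_mul_le (D.P x).2.1 (D.P x).2.2 hv)
  have h3 : |(1 - D.γ) * ∑ i, q i * v i| ≤ 2 * M := by
    rw [abs_mul, abs_of_pos (sub_pos.2 hγ.2)]
    exact (mul_le_of_le_one_left (abs_nonneg _) (by linarith [hγ.1])).trans h1
  rw [objective]
  exact (abs_add_le _ _).trans (by linarith)

lemma le_gap (D : DMDP S A) (q : stdSimplex ℝ S) {M : ℝ} (hM : 1 ≤ M) {v v' : S → ℝ}
    (hv : v ∈ box S (2 * M)) (hv' : v' ∈ box S (2 * M)) {mu mu' : (Σ i, A i) → ℝ}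
    (hmu : mu ∈ stdSimplex ℝ (Σ i, A i)) (hmu' : mu' ∈ stdSimplex ℝ (Σ i, A i)) :
    D.objective q v mu' - D.objective q v' mu ≤ D.gap q M v mu := by
  refine sub_le_sub (le_csSup ⟨7 * M, ?_⟩ ⟨mu', hmu', rfl⟩) (csInf_le ⟨-(7 * M), ?_⟩ ⟨v', hv', rfl⟩)
  · rintro _ ⟨m, hm, rfl⟩
    exact (abs_le.1 (D.abs_objective_le q hM hv hm)).2
  · rintro _ ⟨w, hw, rfl⟩
    exact (abs_le.1 (D.abs_objective_le q hM hw hmu)).1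

lemma gap_le (D : DMDP S A) (q : stdSimplex ℝ S) {M : ℝ} (hM : 0 ≤ M) [Nonempty (Σ i, A i)]
    {v : S → ℝ} {mu : (Σ i, A i) → ℝ} {B : ℝ}
    (h : ∀ v' ∈ box S (2 * M), ∀ mu' ∈ stdSimplex ℝ (Σ i, A i),
      D.objective q v mu' - D.objective q v' mu ≤ B) : D.gap q M v mu ≤ B := by
  classical
  have hne : (stdSimplex ℝ (Σ i, A i)).Nonempty :=
    ⟨_, single_mem_stdSimplex ℝ (Classical.arbitrary (Σ i, A i))⟩
  have hne' : (box S (2 * M)).Nonempty := ⟨0, fun i => by simpa using hM⟩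
  rw [gap, sub_le_iff_le_add]
  refine csSup_le (hne.image _) ?_
  rintro _ ⟨mu', hmu', rfl⟩
  rw [← sub_le_iff_le_add']
  refine le_csInf (hne'.image _) ?_
  rintro _ ⟨v', hv', rfl⟩
  have := h v' hv' mu' hmu'
  simp only
  linarith

/-- A policy read off from a dual iterate is suboptimal by at most `(1 - γ)⁻¹` times the gap. -/
lemma value_sub_value_le (D : DMDP S A) (q : stdSimplex ℝ S) {M : ℝ} (hM : M = (1 - D.γ)⁻¹)
    {v : S → ℝ} (hv : v ∈ box S (2 * M)) {mu : (Σ i, A i) → ℝ}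
    (hmu : mu ∈ stdSimplex ℝ (Σ i, A i)) {lam : stdSimplex ℝ S} {π : Policy S A}
    (h : IsDecomposition mu lam π) (π' : Policy S A) :
    D.value q π' - D.value q π ≤ M * D.gap q M v mu := by
  have hγ := D.γ_mem
  have hM1 : 1 ≤ M := hM ▸ (one_le_inv₀ (sub_pos.2 hγ.2)).2 (by linarith [hγ.1])
  have hmem : D.valueVec π ∈ box S (2 * M) := fun i =>
    ((D.valueVec_mem π) i).trans (by rw [← hM]; linarith)
  have h1 := D.le_gap q hM1 hv hmem hmu (D.occupation_mem q π')
  rw [D.objective_occupation, D.objective_valueVec q h, ← mul_sub] at h1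
  calc D.value q π' - D.value q π
      = M * ((1 - D.γ) * (D.value q π' - D.value q π)) := by
        rw [hM, inv_mul_cancel_left₀ (sub_pos.2 hγ.2).ne']
    _ ≤ _ := mul_le_mul_of_nonneg_left h1 (by linarith)

end

end DMDP

namespace DMDP

noncomputable section

variable {S : Type u} {A : S → Type w} [Fintype S] [∀ i, Fintype (A i)]

/-! ### One-step inequalities for mirror descent -/

lemma sq_clamp_sub_le {m a b : ℝ} (hb : |b| ≤ m) :
    (max (-m) (min m a) - b) ^ 2 ≤ (a - b) ^ 2 := by
  obtain ⟨h1, h2⟩ := abs_le.1 hb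
  refine sq_le_sq.2 ?_
  rcases le_total m a with h | h
  · rw [min_eq_left h, max_eq_right (by linarith), abs_of_nonneg (by linarith),
      abs_of_nonneg (by linarith)]
    linarith
  · rw [min_eq_right h]
    rcases le_total (-m) a with h' | h'
    · rw [max_eq_right h']
    · rw [max_eq_left h', abs_of_nonpos (by linarith), abs_of_nonpos (by linarith)]
      linarith

lemma clamp_mem {m : ℝ} (hm : 0 ≤ m) (a : ℝ) : |max (-m) (min m a)| ≤ m :=
  abs_le.2 ⟨le_max_left _ _, max_le (by linarith) (min_le_left _ _)⟩

lemma projected_step_le {ι : Type*} [Fintype ι] {m η : ℝ} (hη : 0 < η) {v u g : ι → ℝ}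
    (hu : ∀ i, |u i| ≤ m) :
    ∑ i, g i * (v i - u i) + (2 * η)⁻¹ * ∑ i, (max (-m) (min m (v i - η * g i)) - u i) ^ 2 ≤
      (2 * η)⁻¹ * ∑ i, (v i - u i) ^ 2 + η / 2 * ∑ i, g i ^ 2 := by
  simp only [Finset.mul_sum, ← Finset.sum_add_distrib]
  refine Finset.sum_le_sum fun i _ => ?_
  have h := mul_le_mul_of_nonneg_left (sq_clamp_sub_le (a := v i - η * g i) (hu i))
    (inv_nonneg.2 (by linarith : (0 : ℝ) ≤ 2 * η))
  have h2 : (2 * η)⁻¹ * (v i - η * g i - u i) ^ 2 =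
      (2 * η)⁻¹ * (v i - u i) ^ 2 + η / 2 * g i ^ 2 - g i * (v i - u i) := by
    field_simp
    ring
  linarith

/-- The logarithm of an exponentially tilted probability vector's mass. -/
lemma log_sum_mul_exp_le {ι : Type*} [Fintype ι] {p h : ι → ℝ} (hp : ∀ x, 0 ≤ p x)
    (hs : ∑ x, p x = 1) (hh : ∀ x, |h x| ≤ 1) :
    Real.log (∑ x, p x * Real.exp (h x)) ≤ ∑ x, p x * h x + ∑ x, p x * h x ^ 2 := by
  have h1 : ∑ x, p x * Real.exp (h x) ≤ 1 + (∑ x, p x * h x + ∑ x, p x * h x ^ 2) := by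
    rw [← hs, ← Finset.sum_add_distrib, ← Finset.sum_add_distrib]
    refine Finset.sum_le_sum fun x _ => ?_
    have h2 := (abs_le.1 (Real.abs_exp_sub_one_sub_id_le (hh x))).2
    nlinarith [hp x]
  have h2 : 0 < ∑ x, p x * Real.exp (h x) := by
    obtain ⟨x, -, hx⟩ : ∃ x ∈ Finset.univ, p x ≠ 0 := by
      by_contra! hc
      rw [Finset.sum_eq_zero hc] at hs
      exact zero_ne_one hs
    exact Finset.sum_pos' (fun y _ => mul_nonneg (hp y) (Real.exp_pos _).le)
      ⟨x, Finset.mem_univ x, mul_pos ((hp x).lt_of_ne' hx) (Real.exp_pos _)⟩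
  linarith [Real.log_le_sub_one_of_pos h2]

lemma multiplicative_step_le {ι : Type*} [Fintype ι] {η : ℝ} (hη : 0 < η) {mu u g : ι → ℝ}
    (hmu : ∀ x, 0 < mu x) (hs : ∑ x, mu x = 1) (hu : u ∈ stdSimplex ℝ ι)
    (hg : ∀ x, |η * g x| ≤ 1) :
    ∑ x, g x * (mu x - u x) - η⁻¹ * ∑ x, u x * Real.log
        (mu x * Real.exp (-(η * g x)) / ∑ y, mu y * Real.exp (-(η * g y))) ≤
      -(η⁻¹ * ∑ x, u x * Real.log (mu x)) + η * ∑ x, mu x * g x ^ 2 := by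
  have hne : Nonempty ι := by
    by_contra hc
    rw [not_nonempty_iff] at hc
    simp at hs
  set Z := ∑ y, mu y * Real.exp (-(η * g y)) with hZ
  have hZ0 : 0 < Z := Finset.sum_pos (fun y _ => mul_pos (hmu y) (Real.exp_pos _))
    Finset.univ_nonempty
  have h1 : ∑ x, u x * Real.log (mu x * Real.exp (-(η * g x)) / Z) =
      ∑ x, u x * Real.log (mu x) - η * ∑ x, u x * g x - Real.log Z := by
    have : ∀ x, u x * Real.log (mu x * Real.exp (-(η * g x)) / Z) =
        u x * Real.log (mu x) - η * (u x * g x) - u x * Real.log Z := fun x => by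
      rw [Real.log_div (mul_pos (hmu x) (Real.exp_pos _)).ne' hZ0.ne',
        Real.log_mul (hmu x).ne' (Real.exp_pos _).ne', Real.log_exp]
      ring
    simp only [this, Finset.sum_sub_distrib, ← Finset.mul_sum, ← Finset.sum_mul, hu.2, one_mul]
  have h2 : Real.log Z ≤ -(η * ∑ x, mu x * g x) + η ^ 2 * ∑ x, mu x * g x ^ 2 := by
    refine (log_sum_mul_exp_le (fun x => (hmu x).le) hs (h := fun x => -(η * g x))
      (fun x => by rw [abs_neg]; exact hg x)).trans (le_of_eq ?_)
    rw [Finset.mul_sum, Finset.mul_sum, ← Finset.sum_neg_distrib]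
    congr 1 <;> exact Finset.sum_congr rfl fun x _ => by ring
  have h3 : ∑ x, g x * (mu x - u x) = ∑ x, mu x * g x - ∑ x, u x * g x := by
    rw [← Finset.sum_sub_distrib]
    exact Finset.sum_congr rfl fun x _ => by ring
  have h4 := mul_le_mul_of_nonneg_left h2 (inv_nonneg.2 hη.le)
  have h5 : η⁻¹ * (-(η * ∑ x, mu x * g x) + η ^ 2 * ∑ x, mu x * g x ^ 2) =
      -∑ x, mu x * g x + η * ∑ x, mu x * g x ^ 2 := by
    field_simp
  have h6 : η⁻¹ * (η * ∑ x, u x * g x) = ∑ x, u x * g x := inv_mul_cancel_left₀ hη.ne' _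
  rw [h1, h3, mul_sub, mul_sub, h6]
  linarith

/-! ### The expectation over one iteration -/

/-- Expectation over the draws of an iteration that starts at the dual iterate `mu`. -/
def stepExpect (D : DMDP S A) (p : SMDParams S) (mu : (Σ i, A i) → ℝ)
    (f : IterSample S A → ℝ) : ℝ :=
  ∑ s, D.sampleProb p mu s * f s

lemma sampleProb_nonneg (D : DMDP S A) (p : SMDParams S) {mu : (Σ i, A i) → ℝ}
    (h : ∀ x, 0 ≤ mu x) (s : IterSample S A) : 0 ≤ D.sampleProb p mu s := by
  obtain ⟨x, j, i', y, k⟩ := s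
  have h2 : 0 ≤ D.P x j := (D.P x).2.1 j
  have h3 : 0 ≤ D.P y k := (D.P y).2.1 k
  have h4 : 0 ≤ p.q i' := p.q.2.1 i'
  have h5 := h x
  simp only [sampleProb]
  positivity

section stepExpect

variable (D : DMDP S A) (p : SMDParams S) (mu : (Σ i, A i) → ℝ) (f g : IterSample S A → ℝ)

lemma stepExpect_add : D.stepExpect p mu (fun s => f s + g s) =
    D.stepExpect p mu f + D.stepExpect p mu g := by
  simp only [stepExpect, mul_add, Finset.sum_add_distrib]

lemma stepExpect_sub : D.stepExpect p mu (fun s => f s - g s) =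
    D.stepExpect p mu f - D.stepExpect p mu g := by
  simp only [stepExpect, mul_sub, Finset.sum_sub_distrib]

lemma stepExpect_const_mul (c : ℝ) : D.stepExpect p mu (fun s => c * f s) =
    c * D.stepExpect p mu f := by
  simp only [stepExpect, Finset.mul_sum]
  exact Finset.sum_congr rfl fun s _ => by ring

lemma stepExpect_mul_const (c : ℝ) : D.stepExpect p mu (fun s => f s * c) =
    D.stepExpect p mu f * c := by
  simp only [stepExpect, Finset.sum_mul, mul_assoc]

lemma stepExpect_sum {ι : Type*} [Fintype ι] (F : ι → IterSample S A → ℝ) :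
    D.stepExpect p mu (fun s => ∑ i, F i s) = ∑ i, D.stepExpect p mu (F i) := by
  simp only [stepExpect, Finset.mul_sum]
  exact Finset.sum_comm

variable {f g mu}

lemma stepExpect_mono (h : ∀ x, 0 ≤ mu x) (hfg : ∀ s, f s ≤ g s) :
    D.stepExpect p mu f ≤ D.stepExpect p mu g :=
  Finset.sum_le_sum fun s _ => mul_le_mul_of_nonneg_left (hfg s) (D.sampleProb_nonneg p h s)

lemma stepExpect_draws_dual (h : ∑ x, mu x = 1) (F : (Σ i, A i) → S → ℝ) :
    D.stepExpect p mu (fun s => F s.2.2.2.1 s.2.2.2.2) =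
      (D.numPairs : ℝ)⁻¹ * ∑ y, ∑ k, D.P y k * F y k := by
  have hP : ∀ x, ∑ j, D.P x j = 1 := fun x => (D.P x).2.2
  have hq : ∑ j, p.q j = 1 := p.q.2.2
  simp only [stepExpect, Fintype.sum_prod_type, sampleProb, mul_assoc, ← Finset.mul_sum]
  simp only [← Finset.sum_mul, hP, hq, h, one_mul]

variable [Nonempty (Σ i, A i)]

lemma stepExpect_const (h : ∑ x, mu x = 1) (c : ℝ) :
    D.stepExpect p mu (fun _ => c) = c := by
  rw [stepExpect, ← Finset.sum_mul, D.sum_sampleProb p mu h, one_mul]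

lemma stepExpect_sub_mean (h : ∑ x, mu x = 1) :
    D.stepExpect p mu (fun s => f s - D.stepExpect p mu f) = 0 := by
  rw [stepExpect_sub, D.stepExpect_const p h, sub_self]

lemma stepExpect_sub_mean_sq_le (h : ∑ x, mu x = 1) :
    D.stepExpect p mu (fun s => (f s - D.stepExpect p mu f) ^ 2) ≤
      D.stepExpect p mu (fun s => f s ^ 2) := by
  set m := D.stepExpect p mu f with hm
  have h1 : ∀ s, (f s - m) ^ 2 = f s ^ 2 - (2 * m * f s - m ^ 2) := fun s => by ring
  simp only [h1]
  rw [stepExpect_sub, stepExpect_sub, stepExpect_const_mul, D.stepExpect_const p h, ← hm]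
  nlinarith [sq_nonneg m]

lemma stepExpect_draws_primal (F : (Σ i, A i) → S → S → ℝ) :
    D.stepExpect p mu (fun s => F s.1 s.2.1 s.2.2.1) =
      ∑ x, mu x * ∑ j, D.P x j * ∑ i, p.q i * F x j i := by
  have hN : (D.numPairs : ℝ) ≠ 0 := Nat.cast_ne_zero.2 Fintype.card_ne_zero
  have hP : ∀ x, ∑ j, D.P x j = 1 := fun x => (D.P x).2.2
  simp only [stepExpect, Fintype.sum_prod_type, sampleProb, Finset.mul_sum]
  refine Finset.sum_congr rfl fun x _ => Finset.sum_congr rfl fun j _ =>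
    Finset.sum_congr rfl fun i _ => ?_
  simp only [← Finset.sum_mul, ← Finset.mul_sum, hP, mul_one, Finset.sum_const,
    Finset.card_univ, nsmul_eq_mul]
  rw [show (Fintype.card (Σ i, A i) : ℝ) = D.numPairs from rfl]
  field_simp

end stepExpect

/-! ### Means and second moments of the gradient estimators -/

/-- The mean of the `v`-gradient estimator. -/
def meanGradV (D : DMDP S A) (p : SMDParams S) (mu : (Σ i, A i) → ℝ) (i : S) : ℝ :=
  D.stepExpect p mu fun s => D.gradV s i

/-- The mean of the `mu`-gradient estimator. -/
def meanGradMu (D : DMDP S A) (p : SMDParams S) (z : (S → ℝ) × ((Σ i, A i) → ℝ))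
    (x : Σ i, A i) : ℝ :=
  D.stepExpect p z.2 fun s => D.gradMu z.1 s x

lemma sum_gradV_mul (D : DMDP S A) (s : IterSample S A) (w : S → ℝ) :
    ∑ i, D.gradV s i * w i = (1 - D.γ) * w s.2.2.1 + D.γ * w s.2.1 - w s.1.1 := by
  classical
  obtain ⟨x, j, i', y, k⟩ := s
  simp [gradV, sub_mul, add_mul, Finset.sum_add_distrib, Finset.sum_sub_distrib, Pi.single_apply]

lemma sum_gradV_sq_le (D : DMDP S A) (s : IterSample S A) : ∑ i, D.gradV s i ^ 2 ≤ 4 := by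
  classical
  have hγ := D.γ_mem
  have h1 : ∀ i, |D.gradV s i| ≤ 2 := fun i => by
    obtain ⟨x, j, i', y, k⟩ := s
    simp only [gradV, Pi.add_apply, Pi.sub_apply, Pi.smul_apply, Pi.single_apply, smul_eq_mul]
    refine abs_le.2 ?_
    split_ifs <;> constructor <;> linarith [hγ.1, hγ.2]
  have h2 := D.sum_gradV_mul s (fun i => D.gradV s i)
  have h3 := abs_le.1 (h1 s.2.2.1)
  have h4 := abs_le.1 (h1 s.2.1)
  have h5 := abs_le.1 (h1 s.1.1)
  simp only [sq]
  rw [h2]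
  nlinarith [hγ.1, hγ.2]

lemma sum_meanGradV_mul [Nonempty (Σ i, A i)] (D : DMDP S A) (p : SMDParams S)
    {mu : (Σ i, A i) → ℝ} (h : ∑ x, mu x = 1) (w : S → ℝ) :
    ∑ i, D.meanGradV p mu i * w i = (1 - D.γ) * ∑ i, p.q i * w i +
      ∑ x, mu x * (D.γ * ∑ j, D.P x j * w j - w x.1) := by
  have hP : ∀ x, ∑ j, D.P x j = 1 := fun x => (D.P x).2.2
  have hq : ∑ j, p.q j = 1 := p.q.2.2
  simp only [meanGradV, ← stepExpect_mul_const]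
  rw [← stepExpect_sum]
  simp only [sum_gradV_mul]
  rw [D.stepExpect_draws_primal p (fun x j i => (1 - D.γ) * w i + D.γ * w j - w x.1)]
  have h1 : ∀ (x : Σ i, A i) (j : S), ∑ i, p.q i * ((1 - D.γ) * w i + D.γ * w j - w x.1) =
      (1 - D.γ) * ∑ i, p.q i * w i + (D.γ * w j - w x.1) := fun x j => by
    rw [Finset.mul_sum, ← one_mul (D.γ * w j - w x.1), ← hq, Finset.sum_mul,
      ← Finset.sum_add_distrib]
    exact Finset.sum_congr rfl fun i _ => by ring
  have h2 : ∀ x : Σ i, A i, ∑ j, D.P x j * ((1 - D.γ) * ∑ i, p.q i * w i + (D.γ * w j - w x.1)) =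
      (1 - D.γ) * ∑ i, p.q i * w i + (D.γ * ∑ j, D.P x j * w j - w x.1) :=
    fun x => by
    have : ∀ j, D.P x j * ((1 - D.γ) * ∑ i, p.q i * w i + (D.γ * w j - w x.1)) =
      D.P x j * ((1 - D.γ) * ∑ i, p.q i * w i - w x.1) + D.γ * (D.P x j * w j) := fun j => by ring
    simp only [this, Finset.sum_add_distrib, ← Finset.sum_mul, ← Finset.mul_sum, hP]
    ring
  simp only [h1, h2, mul_add (mu _), Finset.sum_add_distrib, ← Finset.sum_mul, h, one_mul]

lemma meanGradMu_eq [Nonempty (Σ i, A i)] (D : DMDP S A) (p : SMDParams S)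
    {z : (S → ℝ) × ((Σ i, A i) → ℝ)} (h : ∑ x, z.2 x = 1) (x : Σ i, A i) :
    D.meanGradMu p z x = -(D.γ * ∑ j, D.P x j * z.1 j - z.1 x.1 + D.r x) := by
  classical
  have hN : (D.numPairs : ℝ) ≠ 0 := Nat.cast_ne_zero.2 Fintype.card_ne_zero
  have hP : ∑ j, D.P x j = 1 := (D.P x).2.2
  have h1 : ∀ s : IterSample S A, D.gradMu z.1 s x = if x = s.2.2.2.1 then
      (D.numPairs : ℝ) * (z.1 s.2.2.2.1.1 - D.γ * z.1 s.2.2.2.2 - D.r s.2.2.2.1) else 0 := by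
    rintro ⟨_, _, _, y, k⟩
    simp only [gradMu, Pi.single_apply]
  simp only [meanGradMu, h1]
  rw [D.stepExpect_draws_dual p h (fun y k => if x = y then
    (D.numPairs : ℝ) * (z.1 y.1 - D.γ * z.1 k - D.r y) else 0)]
  simp only [mul_ite, mul_zero]
  rw [Finset.sum_comm]
  simp only [Finset.sum_ite_eq, Finset.mem_univ, if_true]
  have h2 : ∀ k, D.P x k * ((D.numPairs : ℝ) * (z.1 x.1 - D.γ * z.1 k - D.r x)) =
      D.numPairs * (D.P x k * (z.1 x.1 - D.r x) - D.γ * (D.P x k * z.1 k)) := fun k => by ring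
  simp only [h2, ← Finset.mul_sum, Finset.sum_sub_distrib, ← Finset.sum_mul, hP]
  rw [inv_mul_cancel_left₀ hN]
  ring

lemma abs_gradMu_le (D : DMDP S A) {M : ℝ} (hM : 1 ≤ M) {v : S → ℝ} (hv : v ∈ box S (2 * M))
    (s : IterSample S A) (x : Σ i, A i) : |D.gradMu v s x| ≤ 5 * M * D.numPairs := by
  classical
  obtain ⟨_, _, _, y, k⟩ := s
  have hN : (0 : ℝ) ≤ D.numPairs := Nat.cast_nonneg _
  simp only [gradMu, Pi.single_apply]
  split_ifs
  · rw [abs_mul, abs_of_nonneg hN, mul_comm, ← abs_neg]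
    refine mul_le_mul_of_nonneg_right ?_ hN
    rw [show -(v y.1 - D.γ * v k - D.r y) = D.γ * v k - v y.1 + D.r y by ring]
    exact D.abs_residual_le hM hv y (hv k)
  · rw [abs_zero]; positivity

lemma stepExpect_gradMu_sq_le [Nonempty (Σ i, A i)] (D : DMDP S A) (p : SMDParams S)
    {mu : (Σ i, A i) → ℝ} (h : ∑ x, mu x = 1) {M : ℝ} (hM : 1 ≤ M) {v : S → ℝ}
    (hv : v ∈ box S (2 * M)) (x : Σ i, A i) :
    D.stepExpect p mu (fun s => D.gradMu v s x ^ 2) ≤ 25 * M ^ 2 * D.numPairs := by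
  classical
  have hN : (D.numPairs : ℝ) ≠ 0 := Nat.cast_ne_zero.2 Fintype.card_ne_zero
  have hP : ∑ j, D.P x j = 1 := (D.P x).2.2
  have h1 : ∀ s : IterSample S A, D.gradMu v s x ^ 2 = if x = s.2.2.2.1 then
      ((D.numPairs : ℝ) * (D.γ * v s.2.2.2.2 - v s.2.2.2.1.1 + D.r s.2.2.2.1)) ^ 2 else 0 := by
    rintro ⟨_, _, _, y, k⟩
    simp only [gradMu, Pi.single_apply]
    split_ifs
    · ring
    · ring
  simp only [h1]
  rw [D.stepExpect_draws_dual p h (fun y k => if x = y then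
    ((D.numPairs : ℝ) * (D.γ * v k - v y.1 + D.r y)) ^ 2 else 0)]
  simp only [mul_ite, mul_zero]
  rw [Finset.sum_comm]
  simp only [Finset.sum_ite_eq, Finset.mem_univ, if_true]
  have h2 : ∑ k, D.P x k * ((D.numPairs : ℝ) * (D.γ * v k - v x.1 + D.r x)) ^ 2 ≤
      ∑ k, D.P x k * (D.numPairs ^ 2 * (5 * M) ^ 2) := by
    refine Finset.sum_le_sum fun k _ => mul_le_mul_of_nonneg_left ?_ ((D.P x).2.1 k)
    rw [mul_pow]
    refine mul_le_mul_of_nonneg_left ?_ (sq_nonneg _)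
    exact sq_le_sq.2 ((D.abs_residual_le hM hv x (hv k)).trans (le_abs_self _))
  rw [← Finset.sum_mul, hP, one_mul] at h2
  refine (mul_le_mul_of_nonneg_left h2 (inv_nonneg.2 (Nat.cast_nonneg _))).trans (le_of_eq ?_)
  field_simp
  ring

lemma objective_sub_objective [Nonempty (Σ i, A i)] (D : DMDP S A) (p : SMDParams S)
    {z : (S → ℝ) × ((Σ i, A i) → ℝ)} (h : ∑ x, z.2 x = 1) (v' : S → ℝ)
    (mu' : (Σ i, A i) → ℝ) :
    D.objective p.q z.1 mu' - D.objective p.q v' z.2 =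
      ∑ i, D.meanGradV p z.2 i * (z.1 i - v' i) +
        ∑ x, D.meanGradMu p z x * (z.2 x - mu' x) := by
  have h1 := D.sum_meanGradV_mul p h z.1
  have h2 := D.sum_meanGradV_mul p h v'
  simp only [mul_sub, Finset.sum_sub_distrib, h1, h2, D.meanGradMu_eq p h, objective, mul_add,
    neg_mul, neg_sub, add_mul, sub_mul, neg_add, Finset.sum_add_distrib, Finset.sum_neg_distrib]
  have hc : ∀ f g : (Σ i, A i) → ℝ, ∑ x, f x * g x = ∑ x, g x * f x := fun f g =>
    Finset.sum_congr rfl fun x _ => mul_comm _ _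
  rw [hc _ z.2, hc _ mu', hc _ z.2, hc _ mu', hc _ z.2, hc _ mu']
  ring

end

end DMDP

namespace DMDP

noncomputable section

lemma mem_box_average {S : Type u} {ι : Type*} [Fintype ι] {c m : ℝ} (hc0 : 0 ≤ c)
    (hc : c * Fintype.card ι = 1) {v : ι → S → ℝ} (hv : ∀ t, v t ∈ box S m) :
    c • ∑ t, v t ∈ box S m := by
  intro i
  rw [Pi.smul_apply, Finset.sum_apply, smul_eq_mul, Finset.mul_sum]
  exact abs_sum_mul_le (fun _ => hc0) (by simpa [mul_comm] using hc) fun t => hv t i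

variable {S : Type u} {A : S → Type w} [Fintype S] [∀ i, Fintype (A i)]

/-! ### Expectations over runs -/

lemma runExpect_succ (D : DMDP S A) (p : SMDParams S) (n : ℕ)
    (f : (Fin (n + 1) → IterSample S A) → ℝ) :
    D.runExpect p f = D.runExpect p fun ω : Fin n → IterSample S A =>
      D.stepExpect p (D.iterate p n ω).2 fun s =>
        f (Fin.snoc (α := fun _ => IterSample S A) ω s) := by
  have key : ∀ ω : Fin (n + 1) → IterSample S A, D.runLaw p ω =
      D.runLaw p (Fin.init ω) * D.sampleProb p (D.iterate p n (Fin.init ω)).2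
        (ω (Fin.last n)) := by
    intro ω
    rw [runLaw, Fin.prod_univ_castSucc]
    rfl
  rw [runExpect, ← (Fin.snocEquiv (fun _ : Fin (n + 1) => IterSample S A)).sum_comp,
    Fintype.sum_prod_type_right]
  refine Finset.sum_congr rfl fun ω _ => ?_
  have hi : ∀ s, Fin.init ((Fin.snocEquiv fun _ : Fin (n + 1) => IterSample S A) (s, ω)) = ω :=
    fun s => Fin.init_snoc (α := fun _ : Fin (n + 1) => IterSample S A) s ω
  simp only [key, hi, Fin.snocEquiv_apply, Fin.snoc_last]
  rw [stepExpect, Finset.mul_sum]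
  exact Finset.sum_congr rfl fun s _ => mul_assoc _ _ _

lemma runExpect_mono [Nonempty (Σ i, A i)] (D : DMDP S A) (p : SMDParams S) {n : ℕ}
    {f g : (Fin n → IterSample S A) → ℝ} (h : ∀ ω, f ω ≤ g ω) :
    D.runExpect p f ≤ D.runExpect p g :=
  Finset.sum_le_sum fun ω _ => mul_le_mul_of_nonneg_left (h ω) (D.runLaw_nonneg p ω)

lemma runExpect_const_add_mul [Nonempty (Σ i, A i)] (D : DMDP S A) (p : SMDParams S) {n : ℕ}
    (a b : ℝ) (f : (Fin n → IterSample S A) → ℝ) :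
    D.runExpect p (fun ω => a + b * f ω) = a + b * D.runExpect p f := by
  have h : ∀ ω, D.runLaw p ω * (a + b * f ω) = D.runLaw p ω * a + b * (D.runLaw p ω * f ω) :=
    fun ω => by ring
  simp only [runExpect, h, Finset.sum_add_distrib, ← Finset.sum_mul, ← Finset.mul_sum,
    D.sum_runLaw p n, one_mul]

lemma runExpect_le_of_drift [Nonempty (Σ i, A i)] (D : DMDP S A) (p : SMDParams S)
    (Y : (n : ℕ) → (Fin n → IterSample S A) → ℝ) (y c : ℝ) (h0 : ∀ ω, Y 0 ω ≤ y)
    (hY : ∀ n ω, D.stepExpect p (D.iterate p n ω).2 (fun s =>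
      Y (n + 1) (Fin.snoc (α := fun _ => IterSample S A) ω s)) ≤ Y n ω + c) (n : ℕ) :
    D.runExpect p (Y n) ≤ y + n * c := by
  induction n with
  | zero =>
    have h := D.runExpect_const_add_mul p (n := 0) y 0 (fun _ => 0)
    simp only [zero_mul, add_zero] at h
    simpa [h] using D.runExpect_mono p h0
  | succ n ih =>
    rw [runExpect_succ]
    refine (D.runExpect_mono p (hY n)).trans ?_
    have h := D.runExpect_const_add_mul p c 1 (Y n)
    simp only [one_mul, add_comm c] at h
    rw [h]
    push_cast
    linarith

/-! ### Regret, noise and potential along a run -/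

/-- The error of the `v`-gradient estimator. -/
def noiseV (D : DMDP S A) (p : SMDParams S) (z : (S → ℝ) × ((Σ i, A i) → ℝ))
    (s : IterSample S A) (i : S) : ℝ :=
  D.gradV s i - D.meanGradV p z.2 i

/-- The error of the `mu`-gradient estimator. -/
def noiseMu (D : DMDP S A) (p : SMDParams S) (z : (S → ℝ) × ((Σ i, A i) → ℝ))
    (s : IterSample S A) (x : Σ i, A i) : ℝ :=
  D.gradMu z.1 s x - D.meanGradMu p z x

/-- The accumulated errors of the `v`-gradient estimators. -/
def noiseSumV (D : DMDP S A) (p : SMDParams S) :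
    (n : ℕ) → (Fin n → IterSample S A) → S → ℝ
  | 0, _, _ => 0
  | n + 1, ω, i => D.noiseSumV p n (Fin.init ω) i +
      D.noiseV p (D.iterate p n (Fin.init ω)) (ω (Fin.last n)) i

/-- The accumulated errors of the `mu`-gradient estimators. -/
def noiseSumMu (D : DMDP S A) (p : SMDParams S) :
    (n : ℕ) → (Fin n → IterSample S A) → (Σ i, A i) → ℝ
  | 0, _, _ => 0
  | n + 1, ω, x => D.noiseSumMu p n (Fin.init ω) x +
      D.noiseMu p (D.iterate p n (Fin.init ω)) (ω (Fin.last n)) x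

/-- The part of the one-step regret bound that does not depend on the comparator. -/
def stepResidual (D : DMDP S A) (p : SMDParams S) (z : (S → ℝ) × ((Σ i, A i) → ℝ))
    (s : IterSample S A) : ℝ :=
  2 * p.ηv + p.ημ * ∑ x, z.2 x * D.gradMu z.1 s x ^ 2 -
    (∑ i, D.noiseV p z s i * z.1 i + ∑ x, D.noiseMu p z s x * z.2 x)

/-- The accumulated comparator-free part of the regret bound. -/
def residual (D : DMDP S A) (p : SMDParams S) : (n : ℕ) → (Fin n → IterSample S A) → ℝ
  | 0, _ => 0
  | n + 1, ω => D.residual p n (Fin.init ω) +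
      D.stepResidual p (D.iterate p n (Fin.init ω)) (ω (Fin.last n))

/-- The regret of the iterates `0, …, n - 1` against the comparator `(v', mu')`. -/
def regret (D : DMDP S A) (p : SMDParams S) (v' : S → ℝ) (mu' : (Σ i, A i) → ℝ) :
    (n : ℕ) → (Fin n → IterSample S A) → ℝ
  | 0, _ => 0
  | n + 1, ω => D.regret p v' mu' n (Fin.init ω) +
      (D.objective p.q (D.iterate p n (Fin.init ω)).1 mu' -
        D.objective p.q v' (D.iterate p n (Fin.init ω)).2)

/-- A comparator-free upper bound of the random part of the regret, of small drift. -/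
def potential (D : DMDP S A) (p : SMDParams S) (n : ℕ) (ω : Fin n → IterSample S A) : ℝ :=
  D.residual p n ω + p.ηv / 2 * ∑ i, D.noiseSumV p n ω i ^ 2 +
    p.ημ⁻¹ * Real.log (∑ x, Real.exp (p.ημ * D.noiseSumMu p n ω x))

/-- Conditions on the parameters under which the analysis of the iteration works. -/
structure Admissible (D : DMDP S A) (p : SMDParams S) : Prop where
  one_le_M : 1 ≤ p.M
  v₀_mem : p.v₀ ∈ box S (2 * p.M)
  ηv_pos : 0 < p.ηv
  ημ_pos : 0 < p.ημ
  ημ_le : p.ημ * (10 * p.M * D.numPairs) ≤ 1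

/-! ### The averaged output -/

lemma objective_average_left {ι : Type*} [Fintype ι] (D : DMDP S A) (q : stdSimplex ℝ S)
    {c : ℝ} (hc : c * Fintype.card ι = 1) (v : ι → S → ℝ) (mu : (Σ i, A i) → ℝ) :
    D.objective q (c • ∑ t, v t) mu = c * ∑ t, D.objective q (v t) mu := by
  let L : (S → ℝ) →ₗ[ℝ] ℝ :=
    { toFun := fun v => (1 - D.γ) * ∑ i, q i * v i +
        ∑ x, mu x * (D.γ * ∑ j, D.P x j * v j - v x.1)
      map_add' := fun v w => by
        simp only [Pi.add_apply, mul_add, mul_sub, Finset.sum_add_distrib,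
          Finset.sum_sub_distrib]
        ring
      map_smul' := fun a v => by
        simp only [Pi.smul_apply, smul_eq_mul, RingHom.id_apply, mul_add, Finset.mul_sum,
          mul_sub, mul_left_comm a] }
  have h : ∀ v, D.objective q v mu = L v + ∑ x, mu x * D.r x := fun v => by
    simp only [objective, L, LinearMap.coe_mk, AddHom.coe_mk, mul_add (mu _),
      Finset.sum_add_distrib, add_assoc]
  simp only [h, map_smul, map_sum, Finset.sum_add_distrib, Finset.sum_const, Finset.card_univ,
    nsmul_eq_mul, smul_eq_mul, mul_add]
  rw [← mul_assoc c (Fintype.card ι : ℝ), hc, one_mul]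

lemma objective_average_right {ι : Type*} [Fintype ι] (D : DMDP S A) (q : stdSimplex ℝ S)
    {c : ℝ} (hc : c * Fintype.card ι = 1) (v : S → ℝ) (mu : ι → (Σ i, A i) → ℝ) :
    D.objective q v (c • ∑ t, mu t) = c * ∑ t, D.objective q v (mu t) := by
  let L : ((Σ i, A i) → ℝ) →ₗ[ℝ] ℝ :=
    { toFun := fun mu => ∑ x, mu x * (D.γ * ∑ j, D.P x j * v j - v x.1 + D.r x)
      map_add' := fun v w => by
        simp only [Pi.add_apply, add_mul (v _), Finset.sum_add_distrib]
      map_smul' := fun a v => by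
        simp only [Pi.smul_apply, smul_eq_mul, RingHom.id_apply, Finset.mul_sum, mul_assoc] }
  have h : ∀ mu, D.objective q v mu = (1 - D.γ) * ∑ i, q i * v i + L mu := fun v => rfl
  simp only [h, map_smul, map_sum, Finset.sum_add_distrib, Finset.sum_const, Finset.card_univ,
    nsmul_eq_mul, smul_eq_mul, mul_add c]
  rw [← mul_assoc c (Fintype.card ι : ℝ), hc, one_mul]

lemma output_fst (D : DMDP S A) (p : SMDParams S) {T : ℕ} (ω : Fin T → IterSample S A) :
    (D.output p ω).1 = (T : ℝ)⁻¹ • ∑ t : Fin T,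
      (D.iterate p (t + 1) (Fin.take (t + 1) t.isLt ω)).1 := by
  rw [output, Prod.smul_fst, Prod.fst_sum]

lemma output_snd (D : DMDP S A) (p : SMDParams S) {T : ℕ} (ω : Fin T → IterSample S A) :
    (D.output p ω).2 = (T : ℝ)⁻¹ • ∑ t : Fin T,
      (D.iterate p (t + 1) (Fin.take (t + 1) t.isLt ω)).2 := by
  rw [output, Prod.smul_snd, Prod.snd_sum]

lemma sum_objective_sub_objective (D : DMDP S A) (p : SMDParams S) (v' : S → ℝ)
    (mu' : (Σ i, A i) → ℝ) (n : ℕ) (ω : Fin n → IterSample S A) :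
    ∑ t : Fin n, (D.objective p.q (D.iterate p (t + 1) (Fin.take (t + 1) t.isLt ω)).1 mu' -
        D.objective p.q v' (D.iterate p (t + 1) (Fin.take (t + 1) t.isLt ω)).2) =
      D.regret p v' mu' n ω +
        (D.objective p.q (D.iterate p n ω).1 mu' - D.objective p.q v' (D.iterate p n ω).2) -
        (D.objective p.q p.v₀ mu' - D.objective p.q v' fun _ => (D.numPairs : ℝ)⁻¹) := by
  induction n with
  | zero => simp [regret, iterate]
  | succ n ih =>
    rw [Fin.sum_univ_castSucc]
    have h1 := ih (Fin.init ω)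
    have h2 : Fin.take (n + 1) le_rfl ω = ω := Fin.take_eq_self ω
    simp only [regret]
    refine (congrArg (· + _) h1).trans ?_
    simp only [Fin.val_last, h2]
    ring

lemma inv_mul_card_fin {T : ℕ} (hT : T ≠ 0) : (T : ℝ)⁻¹ * Fintype.card (Fin T) = 1 := by
  rw [Fintype.card_fin, inv_mul_cancel₀ (Nat.cast_ne_zero.2 hT)]

section analysis

variable {D : DMDP S A} {p : SMDParams S}

lemma Admissible.iterate_mem_box (hp : D.Admissible p) :
    ∀ (n : ℕ) (ω : Fin n → IterSample S A), (D.iterate p n ω).1 ∈ box S (2 * p.M)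
  | 0, _ => hp.v₀_mem
  | n + 1, ω => fun i => clamp_mem (by linarith [hp.one_le_M]) _

lemma Admissible.abs_gradMu_le (hp : D.Admissible p) {v : S → ℝ} (hv : v ∈ box S (2 * p.M))
    (s : IterSample S A) (x : Σ i, A i) : |p.ημ * D.gradMu v s x| ≤ 1 := by
  rw [abs_mul, abs_of_pos hp.ημ_pos]
  have h1 := mul_le_mul_of_nonneg_left (D.abs_gradMu_le hp.one_le_M hv s x) hp.ημ_pos.le
  have h2 : 0 ≤ p.ημ * (5 * p.M * D.numPairs) := by
    have := hp.one_le_M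
    have := hp.ημ_pos
    positivity
  linarith [hp.ημ_le]

lemma Admissible.output_fst_mem (hp : D.Admissible p) {T : ℕ} (hT : T ≠ 0)
    (ω : Fin T → IterSample S A) : (D.output p ω).1 ∈ box S (2 * p.M) := by
  rw [output_fst]
  exact mem_box_average (by positivity) (inv_mul_card_fin hT) fun t => hp.iterate_mem_box _ _

variable [Nonempty (Σ i, A i)]

lemma iterate_mem_stdSimplex (D : DMDP S A) (p : SMDParams S) (n : ℕ)
    (ω : Fin n → IterSample S A) : (D.iterate p n ω).2 ∈ stdSimplex ℝ (Σ i, A i) :=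
  ⟨fun x => ((D.iterate_mem p n ω).1 x).le, (D.iterate_mem p n ω).2⟩

lemma Admissible.abs_noiseMu_le (hp : D.Admissible p) {z : (S → ℝ) × ((Σ i, A i) → ℝ)}
    (hv : z.1 ∈ box S (2 * p.M)) (hz : z.2 ∈ stdSimplex ℝ (Σ i, A i)) (s : IterSample S A)
    (x : Σ i, A i) : |p.ημ * D.noiseMu p z s x| ≤ 1 := by
  rw [abs_mul, abs_of_pos hp.ημ_pos]
  have h1 := D.abs_gradMu_le hp.one_le_M hv s x
  have h2 : |D.meanGradMu p z x| ≤ 5 * p.M * D.numPairs :=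
    abs_sum_mul_le (D.sampleProb_nonneg p hz.1) (D.sum_sampleProb p _ hz.2)
      fun s => D.abs_gradMu_le hp.one_le_M hv s x
  have h3 : |D.noiseMu p z s x| ≤ 10 * p.M * D.numPairs :=
    (abs_sub _ _).trans (by linarith)
  exact (mul_le_mul_of_nonneg_left h3 hp.ημ_pos.le).trans hp.ημ_le

lemma Admissible.step_le (hp : D.Admissible p) {z : (S → ℝ) × ((Σ i, A i) → ℝ)}
    (hv : z.1 ∈ box S (2 * p.M)) (hz : ∀ x, 0 < z.2 x) (hz1 : ∑ x, z.2 x = 1)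
    (s : IterSample S A) {v' : S → ℝ} (hv' : v' ∈ box S (2 * p.M)) {mu' : (Σ i, A i) → ℝ}
    (hmu' : mu' ∈ stdSimplex ℝ (Σ i, A i)) :
    D.objective p.q z.1 mu' - D.objective p.q v' z.2 +
        (2 * p.ηv)⁻¹ * ∑ i, ((D.step p z s).1 i - v' i) ^ 2 -
        p.ημ⁻¹ * ∑ x, mu' x * Real.log ((D.step p z s).2 x) ≤
      (2 * p.ηv)⁻¹ * ∑ i, (z.1 i - v' i) ^ 2 - p.ημ⁻¹ * ∑ x, mu' x * Real.log (z.2 x) +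
        D.stepResidual p z s + ∑ i, D.noiseV p z s i * v' i + ∑ x, D.noiseMu p z s x * mu' x := by
  have h1 := projected_step_le (m := 2 * p.M) hp.ηv_pos (v := z.1) (u := v')
    (g := D.gradV s) hv'
  have h2 := multiplicative_step_le hp.ημ_pos hz hz1 hmu' (hp.abs_gradMu_le hv s)
  have h3 := mul_le_mul_of_nonneg_left (D.sum_gradV_sq_le s) (half_pos hp.ηv_pos).le
  have h4 := D.objective_sub_objective p hz1 v' mu'
  have h5 : ∑ i, D.gradV s i * (z.1 i - v' i) = ∑ i, D.meanGradV p z.2 i * (z.1 i - v' i) +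
      (∑ i, D.noiseV p z s i * z.1 i - ∑ i, D.noiseV p z s i * v' i) := by
    rw [← Finset.sum_sub_distrib, ← Finset.sum_add_distrib]
    exact Finset.sum_congr rfl fun i _ => by rw [noiseV]; ring
  have h6 : ∑ x, D.gradMu z.1 s x * (z.2 x - mu' x) =
      ∑ x, D.meanGradMu p z x * (z.2 x - mu' x) +
      (∑ x, D.noiseMu p z s x * z.2 x - ∑ x, D.noiseMu p z s x * mu' x) := by
    rw [← Finset.sum_sub_distrib, ← Finset.sum_add_distrib]
    exact Finset.sum_congr rfl fun i _ => by rw [noiseMu]; ring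
  simp only [stepResidual, step]
  linarith

lemma Admissible.regret_add_le (hp : D.Admissible p) {v' : S → ℝ}
    (hv' : v' ∈ box S (2 * p.M)) {mu' : (Σ i, A i) → ℝ} (hmu' : mu' ∈ stdSimplex ℝ (Σ i, A i))
    (n : ℕ) (ω : Fin n → IterSample S A) :
    D.regret p v' mu' n ω + (2 * p.ηv)⁻¹ * ∑ i, ((D.iterate p n ω).1 i - v' i) ^ 2 -
        p.ημ⁻¹ * ∑ x, mu' x * Real.log ((D.iterate p n ω).2 x) ≤
      (2 * p.ηv)⁻¹ * ∑ i, (p.v₀ i - v' i) ^ 2 + p.ημ⁻¹ * Real.log D.numPairs +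
        D.residual p n ω + ∑ i, D.noiseSumV p n ω i * v' i +
        ∑ x, D.noiseSumMu p n ω x * mu' x := by
  induction n with
  | zero =>
    simp only [regret, iterate, residual, noiseSumV, noiseSumMu, zero_mul, Finset.sum_const_zero,
      Real.log_inv, ← Finset.sum_mul, hmu'.2]
    linarith
  | succ n ih =>
    have h1 := ih (Fin.init ω)
    have h2 := hp.step_le (hp.iterate_mem_box n (Fin.init ω))
      (D.iterate_mem p n (Fin.init ω)).1 (D.iterate_mem p n (Fin.init ω)).2 (ω (Fin.last n))
      hv' hmu'
    simp only [regret, iterate, residual, noiseSumV, noiseSumMu, add_mul,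
      Finset.sum_add_distrib]
    linarith

lemma sum_mul_le_log_sum_exp {ι : Type*} [Fintype ι] {η : ℝ} (hη : 0 < η) {u : ι → ℝ}
    (hu : u ∈ stdSimplex ℝ ι) (g : ι → ℝ) :
    ∑ x, g x * u x ≤ η⁻¹ * Real.log (∑ x, Real.exp (η * g x)) := by
  have h1 : ∀ x, g x ≤ η⁻¹ * Real.log (∑ x, Real.exp (η * g x)) := fun x => by
    rw [inv_mul_eq_div, le_div_iff₀ hη, mul_comm, ← Real.log_exp (η * g x)]
    exact Real.log_le_log (Real.exp_pos _) (Finset.single_le_sum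
      (f := fun x => Real.exp (η * g x)) (fun y _ => (Real.exp_pos _).le) (Finset.mem_univ x))
  calc ∑ x, g x * u x ≤ ∑ x, η⁻¹ * Real.log (∑ x, Real.exp (η * g x)) * u x :=
        Finset.sum_le_sum fun x _ => mul_le_mul_of_nonneg_right (h1 x) (hu.1 x)
    _ = _ := by rw [← Finset.mul_sum, hu.2, mul_one]

lemma Admissible.regret_le (hp : D.Admissible p) {v' : S → ℝ}
    (hv' : v' ∈ box S (2 * p.M)) {mu' : (Σ i, A i) → ℝ} (hmu' : mu' ∈ stdSimplex ℝ (Σ i, A i))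
    (n : ℕ) (ω : Fin n → IterSample S A) :
    D.regret p v' mu' n ω ≤ 10 * p.M ^ 2 * Fintype.card S / p.ηv +
      p.ημ⁻¹ * Real.log D.numPairs + D.potential p n ω := by
  have hηv := hp.ηv_pos
  have h1 := hp.regret_add_le hv' hmu' n ω
  have h2 : 0 ≤ (2 * p.ηv)⁻¹ * ∑ i, ((D.iterate p n ω).1 i - v' i) ^ 2 := by positivity
  have h3 : p.ημ⁻¹ * ∑ x, mu' x * Real.log ((D.iterate p n ω).2 x) ≤ 0 := by
    refine mul_nonpos_of_nonneg_of_nonpos (inv_nonneg.2 hp.ημ_pos.le)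
      (Finset.sum_nonpos fun x _ => mul_nonpos_of_nonneg_of_nonpos (hmu'.1 x) ?_)
    obtain ⟨h4, h5⟩ := D.iterate_mem p n ω
    refine Real.log_nonpos (h4 x).le ?_
    rw [← h5]
    exact Finset.single_le_sum (fun y _ => (h4 y).le) (Finset.mem_univ x)
  have h4 : (2 * p.ηv)⁻¹ * ∑ i, (p.v₀ i - v' i) ^ 2 ≤
      (2 * p.ηv)⁻¹ * ∑ i : S, (4 * p.M) ^ 2 := by
    refine mul_le_mul_of_nonneg_left (Finset.sum_le_sum fun i _ => sq_le_sq.2 ?_) (by positivity)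
    refine le_trans ((abs_sub _ _).trans ?_) (le_abs_self _)
    linarith [hp.v₀_mem i, hv' i]
  have h5 : ∑ i, D.noiseSumV p n ω i * v' i ≤
      ∑ i, (2 * p.M ^ 2 / p.ηv + p.ηv / 2 * D.noiseSumV p n ω i ^ 2) := by
    refine Finset.sum_le_sum fun i _ => ?_
    have h6 : v' i ^ 2 ≤ (2 * p.M) ^ 2 := sq_le_sq.2 ((hv' i).trans (le_abs_self _))
    have h7 : 0 ≤ (p.ηv * D.noiseSumV p n ω i - v' i) ^ 2 / (2 * p.ηv) := by positivity
    have h8 : (p.ηv * D.noiseSumV p n ω i - v' i) ^ 2 / (2 * p.ηv) =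
        v' i ^ 2 / (2 * p.ηv) + p.ηv / 2 * D.noiseSumV p n ω i ^ 2 -
          D.noiseSumV p n ω i * v' i := by
      field_simp
      ring
    have h9 : v' i ^ 2 / (2 * p.ηv) ≤ 2 * p.M ^ 2 / p.ηv := by
      rw [div_le_div_iff₀ (by positivity) hηv]
      nlinarith
    linarith
  have h6 := sum_mul_le_log_sum_exp hp.ημ_pos hmu' (D.noiseSumMu p n ω)
  rw [Finset.sum_add_distrib, ← Finset.mul_sum, Finset.sum_const, Finset.card_univ,
    nsmul_eq_mul] at h5
  rw [Finset.sum_const, Finset.card_univ, nsmul_eq_mul] at h4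
  have h7 : (2 * p.ηv)⁻¹ * (Fintype.card S * (4 * p.M) ^ 2) +
      Fintype.card S * (2 * p.M ^ 2 / p.ηv) = 10 * p.M ^ 2 * Fintype.card S / p.ηv := by
    field_simp
    ring
  rw [potential]
  linarith

/-! ### The drift of the potential -/

lemma Admissible.stepExpect_stepResidual_le (hp : D.Admissible p)
    {z : (S → ℝ) × ((Σ i, A i) → ℝ)} (hv : z.1 ∈ box S (2 * p.M))
    (hz : z.2 ∈ stdSimplex ℝ (Σ i, A i)) :
    D.stepExpect p z.2 (D.stepResidual p z) ≤
      2 * p.ηv + p.ημ * (25 * p.M ^ 2 * D.numPairs) := by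
  have h1 : ∀ i, D.stepExpect p z.2 (fun s => D.noiseV p z s i) = 0 := fun i =>
    D.stepExpect_sub_mean p hz.2
  have h2 : ∀ x, D.stepExpect p z.2 (fun s => D.noiseMu p z s x) = 0 := fun x =>
    D.stepExpect_sub_mean p hz.2
  have h3 : D.stepExpect p z.2 (D.stepResidual p z) = 2 * p.ηv +
      p.ημ * ∑ x, z.2 x * D.stepExpect p z.2 (fun s => D.gradMu z.1 s x ^ 2) := by
    unfold stepResidual
    rw [stepExpect_sub, stepExpect_add, stepExpect_add, D.stepExpect_const p hz.2,
      stepExpect_const_mul, stepExpect_sum, stepExpect_sum, stepExpect_sum]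
    simp only [stepExpect_const_mul, stepExpect_mul_const, h1, h2, zero_mul,
      Finset.sum_const_zero, add_zero, sub_zero]
  rw [h3]
  refine add_le_add_right (mul_le_mul_of_nonneg_left ?_ hp.ημ_pos.le) _
  calc ∑ x, z.2 x * D.stepExpect p z.2 (fun s => D.gradMu z.1 s x ^ 2)
      ≤ ∑ x, z.2 x * (25 * p.M ^ 2 * D.numPairs) := Finset.sum_le_sum fun x _ =>
        mul_le_mul_of_nonneg_left (D.stepExpect_gradMu_sq_le p hz.2 hp.one_le_M hv x) (hz.1 x)
    _ = _ := by rw [← Finset.sum_mul, hz.2, one_mul]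

lemma stepExpect_noiseSumV_sq_le {z : (S → ℝ) × ((Σ i, A i) → ℝ)}
    (hz : z.2 ∈ stdSimplex ℝ (Σ i, A i)) (X : S → ℝ) :
    D.stepExpect p z.2 (fun s => ∑ i, (X i + D.noiseV p z s i) ^ 2) ≤ ∑ i, X i ^ 2 + 4 := by
  have h1 : ∀ i, D.stepExpect p z.2 (fun s => D.noiseV p z s i) = 0 := fun i =>
    D.stepExpect_sub_mean p hz.2
  have h2 : ∀ s i, (X i + D.noiseV p z s i) ^ 2 =
      X i ^ 2 + (2 * X i * D.noiseV p z s i + D.noiseV p z s i ^ 2) := fun s i => by ring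
  have h3 : ∑ i, D.stepExpect p z.2 (fun s => D.noiseV p z s i ^ 2) ≤ 4 :=
    calc ∑ i, D.stepExpect p z.2 (fun s => D.noiseV p z s i ^ 2)
        ≤ ∑ i, D.stepExpect p z.2 (fun s => D.gradV s i ^ 2) :=
          Finset.sum_le_sum fun i _ => D.stepExpect_sub_mean_sq_le p hz.2
      _ = D.stepExpect p z.2 (fun s => ∑ i, D.gradV s i ^ 2) := (stepExpect_sum _ _ _ _).symm
      _ ≤ D.stepExpect p z.2 (fun _ => 4) := D.stepExpect_mono p hz.1 D.sum_gradV_sq_le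
      _ = 4 := D.stepExpect_const p hz.2 4
  rw [stepExpect_sum]
  simp only [h2, stepExpect_add, stepExpect_const_mul, h1, D.stepExpect_const p hz.2, mul_zero,
    zero_add, Finset.sum_add_distrib]
  linarith

lemma Admissible.stepExpect_log_sum_exp_le (hp : D.Admissible p)
    {z : (S → ℝ) × ((Σ i, A i) → ℝ)} (hv : z.1 ∈ box S (2 * p.M))
    (hz : z.2 ∈ stdSimplex ℝ (Σ i, A i)) (X : (Σ i, A i) → ℝ) :
    D.stepExpect p z.2 (fun s => Real.log (∑ x, Real.exp (p.ημ * (X x + D.noiseMu p z s x)))) ≤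
      Real.log (∑ x, Real.exp (p.ημ * X x)) + p.ημ ^ 2 * (25 * p.M ^ 2 * D.numPairs) := by
  set W := ∑ x, Real.exp (p.ημ * X x) with hW
  have hW0 : 0 < W := Finset.sum_pos (fun x _ => Real.exp_pos _) Finset.univ_nonempty
  let w : (Σ i, A i) → ℝ := fun x => Real.exp (p.ημ * X x) / W
  have hw : ∀ x, 0 ≤ w x := fun x => div_nonneg (Real.exp_pos _).le hW0.le
  have hw1 : ∑ x, w x = 1 := by
    simp only [w]
    rw [← Finset.sum_div, ← hW, div_self hW0.ne']
  have h1 : ∀ x, D.stepExpect p z.2 (fun s => D.noiseMu p z s x) = 0 := fun x =>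
    D.stepExpect_sub_mean p hz.2
  have h2 : ∀ s, Real.log (∑ x, Real.exp (p.ημ * (X x + D.noiseMu p z s x))) ≤ Real.log W +
      (∑ x, w x * (p.ημ * D.noiseMu p z s x) + ∑ x, w x * (p.ημ * D.noiseMu p z s x) ^ 2) := by
    intro s
    have h3 : ∑ x, Real.exp (p.ημ * (X x + D.noiseMu p z s x)) =
        W * ∑ x, w x * Real.exp (p.ημ * D.noiseMu p z s x) := by
      rw [Finset.mul_sum]
      refine Finset.sum_congr rfl fun x _ => ?_
      rw [mul_add, Real.exp_add]
      simp only [w]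
      field_simp
    have h4 : ∑ x, w x * Real.exp (p.ημ * D.noiseMu p z s x) ≠ 0 := by
      intro h
      rw [h, mul_zero] at h3
      exact (Finset.sum_pos (fun x _ => Real.exp_pos (p.ημ * (X x + D.noiseMu p z s x)))
        Finset.univ_nonempty).ne' h3
    rw [h3, Real.log_mul hW0.ne' h4]
    exact add_le_add_right (log_sum_mul_exp_le hw hw1 (hp.abs_noiseMu_le hv hz s)) _
  refine (D.stepExpect_mono p hz.1 h2).trans ?_
  rw [stepExpect_add, stepExpect_add, D.stepExpect_const p hz.2, stepExpect_sum, stepExpect_sum]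
  simp only [stepExpect_const_mul, mul_pow, h1, mul_zero, Finset.sum_const_zero, zero_add]
  refine add_le_add_right ?_ _
  calc ∑ x, w x * (p.ημ ^ 2 * D.stepExpect p z.2 (fun s => D.noiseMu p z s x ^ 2))
      ≤ ∑ x, w x * (p.ημ ^ 2 * (25 * p.M ^ 2 * D.numPairs)) := Finset.sum_le_sum fun x _ =>
        mul_le_mul_of_nonneg_left (mul_le_mul_of_nonneg_left
          ((D.stepExpect_sub_mean_sq_le p hz.2).trans
            (D.stepExpect_gradMu_sq_le p hz.2 hp.one_le_M hv x)) (sq_nonneg _)) (hw x)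
    _ = _ := by rw [← Finset.sum_mul, hw1, one_mul]

lemma Admissible.runExpect_potential_le (hp : D.Admissible p) (n : ℕ) :
    D.runExpect p (D.potential p n) ≤ p.ημ⁻¹ * Real.log D.numPairs +
      n * (4 * p.ηv + 50 * p.ημ * p.M ^ 2 * D.numPairs) := by
  refine D.runExpect_le_of_drift p (D.potential p) _ _ (fun ω => ?_) (fun n ω => ?_) n
  · simp [potential, residual, noiseSumV, noiseSumMu, numPairs]
  · have hv := hp.iterate_mem_box n ω
    have hz := iterate_mem_stdSimplex D p n ω
    simp only [potential, residual, noiseSumV, noiseSumMu, Fin.init_snoc, Fin.snoc_last]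
    rw [stepExpect_add, stepExpect_add, stepExpect_add, D.stepExpect_const p hz.2,
      stepExpect_const_mul, stepExpect_const_mul]
    have h1 := hp.stepExpect_stepResidual_le hv hz
    have h2 := mul_le_mul_of_nonneg_left (stepExpect_noiseSumV_sq_le (D := D) (p := p) hz
      (D.noiseSumV p n ω)) (half_pos hp.ηv_pos).le
    have h3 := mul_le_mul_of_nonneg_left (hp.stepExpect_log_sum_exp_le hv hz
      (D.noiseSumMu p n ω)) (inv_nonneg.2 hp.ημ_pos.le)
    have h4 : p.ημ⁻¹ * (p.ημ ^ 2 * (25 * p.M ^ 2 * D.numPairs)) =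
        p.ημ * (25 * p.M ^ 2 * D.numPairs) := by
      have := hp.ημ_pos.ne'
      field_simp
    rw [mul_add, h4] at h3
    linarith

/-! ### The gap of the output -/

lemma output_snd_pos (D : DMDP S A) (p : SMDParams S) {T : ℕ} (hT : T ≠ 0)
    (ω : Fin T → IterSample S A) (x : Σ i, A i) : 0 < (D.output p ω).2 x := by
  have : NeZero T := ⟨hT⟩
  rw [output_snd, Pi.smul_apply, Finset.sum_apply, smul_eq_mul]
  exact mul_pos (inv_pos.2 (Nat.cast_pos.2 (Nat.pos_of_ne_zero hT)))
    (Finset.sum_pos (fun t _ => (D.iterate_mem p _ _).1 x) Finset.univ_nonempty)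

lemma output_snd_mem (D : DMDP S A) (p : SMDParams S) {T : ℕ} (hT : T ≠ 0)
    (ω : Fin T → IterSample S A) : (D.output p ω).2 ∈ stdSimplex ℝ (Σ i, A i) := by
  refine ⟨fun x => (D.output_snd_pos p hT ω x).le, ?_⟩
  rw [output_snd]
  simp only [Pi.smul_apply, Finset.sum_apply, smul_eq_mul, ← Finset.mul_sum]
  rw [Finset.sum_comm]
  simp only [(D.iterate_mem p _ _).2, Finset.sum_const, Finset.card_univ, nsmul_eq_mul, mul_one]
  exact inv_mul_card_fin hT

lemma Admissible.gap_output_le (hp : D.Admissible p) {T : ℕ} (hT : T ≠ 0)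
    (ω : Fin T → IterSample S A) :
    D.gap p.q p.M (D.output p ω).1 (D.output p ω).2 ≤
      (T : ℝ)⁻¹ * (28 * p.M + 10 * p.M ^ 2 * Fintype.card S / p.ηv +
        p.ημ⁻¹ * Real.log D.numPairs + D.potential p T ω) := by
  have hM := hp.one_le_M
  refine D.gap_le p.q (by linarith) fun v' hv' mu' hmu' => ?_
  rw [output_fst, output_snd, D.objective_average_left p.q (inv_mul_card_fin hT),
    D.objective_average_right p.q (inv_mul_card_fin hT), ← mul_sub, ← Finset.sum_sub_distrib,
    D.sum_objective_sub_objective]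
  refine mul_le_mul_of_nonneg_left ?_ (by positivity)
  have h0 := D.abs_objective_le p.q hM (hp.iterate_mem_box T ω) hmu'
  have h1 := D.abs_objective_le p.q hM hv' (iterate_mem_stdSimplex D p T ω)
  have h2 := D.abs_objective_le p.q hM hp.v₀_mem hmu'
  have h3 := D.abs_objective_le p.q hM hv' (iterate_mem_stdSimplex D p 0 Fin.elim0)
  simp only [iterate] at h3
  linarith [hp.regret_le hv' hmu' T ω, (abs_le.1 h0).2, (abs_le.1 h1).1, (abs_le.1 h2).1,
    (abs_le.1 h3).2]

/-- The expected duality gap of the output, for general step sizes. -/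
theorem Admissible.runExpect_gap_le (hp : D.Admissible p) {T : ℕ} (hT : T ≠ 0) :
    D.runExpect p (fun ω : Fin T → IterSample S A =>
        D.gap p.q p.M (D.output p ω).1 (D.output p ω).2) ≤
      (T : ℝ)⁻¹ * (28 * p.M + 10 * p.M ^ 2 * Fintype.card S / p.ηv +
        2 * (p.ημ⁻¹ * Real.log D.numPairs)) +
        (4 * p.ηv + 50 * p.ημ * p.M ^ 2 * D.numPairs) := by
  have hT' : (T : ℝ) ≠ 0 := Nat.cast_ne_zero.2 hT
  refine (D.runExpect_mono p (hp.gap_output_le hT)).trans ?_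
  simp only [mul_add (T : ℝ)⁻¹ _ (D.potential p T _)]
  rw [D.runExpect_const_add_mul]
  have h := mul_le_mul_of_nonneg_left (hp.runExpect_potential_le T)
    (inv_nonneg.2 (Nat.cast_nonneg T))
  rw [mul_add, inv_mul_cancel_left₀ hT'] at h
  linarith

end analysis

end

end DMDP

namespace DMDP

noncomputable section

lemma sampleCount_eq {S : Type u} {A : S → Type w} {T : ℕ} (ω : Fin T → IterSample S A) : sampleCount ω = 5 * T := by
  have h : ∀ s : IterSample S A, s.draws.length = 5 := fun _ => rfl
  simp [sampleCount, h, mul_comm]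

variable {S : Type u} {A : S → Type w} [Fintype S] [∀ i, Fintype (A i)]

/-! ### Decomposition of a positive dual vector -/

lemma existsUnique_isDecomposition [∀ i, Nonempty (A i)] {mu : (Σ i, A i) → ℝ}
    (hpos : ∀ x, 0 < mu x) (hs : ∑ x, mu x = 1) :
    ∃! d : stdSimplex ℝ S × Policy S A, IsDecomposition mu d.1 d.2 := by
  have hl : ∀ i, 0 < ∑ a, mu ⟨i, a⟩ := fun i =>
    Finset.sum_pos (fun a _ => hpos _) Finset.univ_nonempty
  refine ⟨⟨⟨fun i => ∑ a, mu ⟨i, a⟩, fun i => (hl i).le, ?_⟩,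
    fun i => ⟨fun a => mu ⟨i, a⟩ / ∑ a, mu ⟨i, a⟩, fun a => (div_pos (hpos _) (hl i)).le, ?_⟩⟩,
    ?_, ?_⟩
  · rw [← hs, Fintype.sum_sigma]
  · rw [← Finset.sum_div, div_self (hl i).ne']
  · exact fun i a => (mul_div_cancel₀ (mu ⟨i, a⟩) (hl i).ne').symm
  · rintro ⟨lam, π⟩ h
    have h1 : ∀ i, lam i = ∑ a, mu ⟨i, a⟩ := fun i => by
      have hπ : ∑ a, π i a = 1 := (π i).2.2
      have h2 : ∀ a, mu ⟨i, a⟩ = lam i * π i a := h i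
      simp only [h2, ← Finset.mul_sum, hπ, mul_one]
    refine Prod.ext (Subtype.ext (funext h1)) (funext fun i => Subtype.ext (funext fun a => ?_))
    have h2 : mu ⟨i, a⟩ = lam i * π i a := h i a
    rw [h1] at h2
    exact (eq_div_iff (hl i).ne').2 (by rw [h2, mul_comm]; rfl)

lemma card_le_numPairs [∀ i, Nonempty (A i)] (D : DMDP S A) : Fintype.card S ≤ D.numPairs :=
  Fintype.card_le_of_injective (fun i => (⟨i, Classical.arbitrary (A i)⟩ : Σ i, A i))
    fun _ _ h => congrArg Sigma.fst h

/-- The bound of `Admissible.runExpect_gap_le` for the concrete step sizes. -/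
lemma gap_bound_le {M N n e T ℓ : ℝ} (hM : 1 ≤ M) (hN : 2 ≤ N) (hn : n ≤ N) (he : 0 < e)
    (he1 : e ≤ 1) (hℓ : 1 / 2 ≤ ℓ) (hT : 10000 * (M ^ 2 * N * ℓ / e ^ 2) ≤ T) :
    T⁻¹ * (28 * M + 10 * M ^ 2 * n / (1 / 20 * e) +
        2 * ((1 / 250 * e / (M ^ 2 * N))⁻¹ * ℓ)) +
      (4 * (1 / 20 * e) + 50 * (1 / 250 * e / (M ^ 2 * N)) * M ^ 2 * N) ≤ e := by
  have hX : 0 < M ^ 2 * N * ℓ := by positivity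
  have hT0 : 0 < T := lt_of_lt_of_le (by positivity) hT
  have h1 : M ^ 2 * N * ℓ ≤ T * e ^ 2 / 10000 := by
    rw [← mul_div_assoc, div_le_iff₀ (by positivity)] at hT
    linarith
  have h2 : 50 * (1 / 250 * e / (M ^ 2 * N)) * M ^ 2 * N = 1 / 5 * e := by
    field_simp
    norm_num
  have h3 : 2 * ((1 / 250 * e / (M ^ 2 * N))⁻¹ * ℓ) = 500 * (M ^ 2 * N * ℓ) / e := by
    field_simp
    norm_num
  have h4 : 10 * M ^ 2 * n / (1 / 20 * e) ≤ 400 * (M ^ 2 * N * ℓ) / e := by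
    rw [show 10 * M ^ 2 * n / (1 / 20 * e) = 200 * (M ^ 2 * n) / e by field_simp; ring]
    refine div_le_div_of_nonneg_right ?_ he.le
    have h5 : M ^ 2 * n ≤ M ^ 2 * N := mul_le_mul_of_nonneg_left hn (sq_nonneg _)
    have h6 : M ^ 2 * N * (1 / 2) ≤ M ^ 2 * N * ℓ := mul_le_mul_of_nonneg_left hℓ (by positivity)
    linarith
  have h5 : 28 * M ≤ 28 * (M ^ 2 * N * ℓ) / e := by
    rw [le_div_iff₀ he]
    have h6 : 1 ≤ N * ℓ := by nlinarith
    have h7 : M * e ≤ M * 1 := mul_le_mul_of_nonneg_left he1 (by linarith)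
    nlinarith
  have h6 : T⁻¹ * (28 * M + 10 * M ^ 2 * n / (1 / 20 * e) +
      2 * ((1 / 250 * e / (M ^ 2 * N))⁻¹ * ℓ)) ≤ 928 / 10000 * e := by
    rw [inv_mul_le_iff₀ hT0, h3]
    have h7 : 928 * (M ^ 2 * N * ℓ) / e ≤ 928 * (T * e ^ 2 / 10000) / e :=
      div_le_div_of_nonneg_right (by linarith) he.le
    have h8 : 928 * (T * e ^ 2 / 10000) / e = T * (928 / 10000 * e) := by
      field_simp
    have h9 : 928 * (M ^ 2 * N * ℓ) / e = 28 * (M ^ 2 * N * ℓ) / e + 400 * (M ^ 2 * N * ℓ) / e +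
      500 * (M ^ 2 * N * ℓ) / e := by ring
    linarith
  rw [h2]
  linarith

end

end DMDP

open DMDP in
theorem mainTheorem2 :
    ∃ cv cμ cT C : ℝ, 0 < cv ∧ 0 < cμ ∧ 0 < cT ∧ 0 < C ∧
      ∀ (S : Type u) (A : S → Type w) [Fintype S] [∀ i, Fintype (A i)] [∀ i, Nonempty (A i)]
        (D : DMDP S A) (q : stdSimplex ℝ S) (ε : ℝ) (v₀ : S → ℝ),
        2 ≤ D.numPairs → ε ∈ Set.Ioo (0 : ℝ) 1 →
        ∀ (M acc : ℝ) (T : ℕ) (p : SMDParams S),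
          M = (1 - D.γ)⁻¹ →
          acc = (1 - D.γ) * ε / 3 →
          v₀ ∈ box S (2 * M) →
          T = ⌈cT * (M ^ 2 * D.numPairs * Real.log D.numPairs / acc ^ 2)⌉₊ →
          p = { q := q, v₀ := v₀, M := M, ηv := cv * acc,
                ημ := cμ * acc / (M ^ 2 * D.numPairs) } →
          -- the output is an expected `acc`-approximate solution of the minimax problem
          D.runExpect p (fun ω : Fin T → IterSample S A =>
              D.gap q M (D.output p ω).1 (D.output p ω).2) ≤ acc ∧
          -- the dual output has a unique decomposition
          (∀ ω : Fin T → IterSample S A, ∃! d : stdSimplex ℝ S × Policy S A,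
            IsDecomposition (D.output p ω).2 d.1 d.2) ∧
          -- the policy read off from it is an expected `ε`-optimal policy
          (∀ (lam : (Fin T → IterSample S A) → stdSimplex ℝ S)
            (π : (Fin T → IterSample S A) → Policy S A),
            (∀ ω, IsDecomposition (D.output p ω).2 (lam ω) (π ω)) →
            D.optValue q - ε ≤ D.runExpect p (fun ω => D.value q (π ω))) ∧
          -- the number of samples
          (∀ ω : Fin T → IterSample S A, (sampleCount ω : ℝ) ≤
            C * ((1 - D.γ) ^ (-4 : ℤ) * D.numPairs * ε ^ (-2 : ℤ) * Real.log D.numPairs)) := by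
  refine ⟨1 / 20, 1 / 250, 10000, 45 * 10001, by norm_num, by norm_num, by norm_num,
    by norm_num, ?_⟩
  intro S A _ _ _ D q ε v₀ hN hε M acc T p hM hacc hv₀ hT hp
  obtain ⟨hγ0, hγ1⟩ := D.γ_mem
  obtain ⟨hε0, hε1⟩ := hε
  have : Nonempty (Σ i, A i) := Fintype.card_pos_iff.1 (lt_of_lt_of_le two_pos hN)
  have hg : 0 < 1 - D.γ := sub_pos.2 hγ1
  have hM1 : 1 ≤ M := hM ▸ (one_le_inv₀ hg).2 (by linarith)
  have hacc0 : 0 < acc := by rw [hacc]; positivity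
  have hacc1 : acc ≤ 1 := by
    rw [hacc]
    nlinarith
  have hN2 : (2 : ℝ) ≤ D.numPairs := by exact_mod_cast hN
  have hN0 : (0 : ℝ) < D.numPairs := by linarith
  have hlog : 1 / 2 ≤ Real.log D.numPairs :=
    le_trans (by linarith [Real.log_two_gt_d9]) (Real.log_le_log two_pos hN2)
  have hlog0 : 0 < Real.log D.numPairs := by linarith
  set X := M ^ 2 * D.numPairs * Real.log D.numPairs / acc ^ 2 with hX
  have hX1 : 1 ≤ X := by
    rw [hX, le_div_iff₀ (by positivity), one_mul]
    have h1 : acc ^ 2 ≤ 1 := pow_le_one₀ hacc0.le hacc1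
    have h2 : 1 ≤ M ^ 2 := one_le_pow₀ hM1
    have h3 : 1 ≤ D.numPairs * Real.log D.numPairs := by nlinarith
    nlinarith
  have hTX : 10000 * X ≤ T := hT ▸ Nat.le_ceil _
  have hT0 : T ≠ 0 := by
    rintro rfl
    rw [Nat.cast_zero] at hTX
    linarith
  have hadm : D.Admissible p := by
    subst hp
    refine ⟨hM1, hv₀, by positivity, by positivity, ?_⟩
    change 1 / 250 * acc / (M ^ 2 * D.numPairs) * (10 * M * D.numPairs) ≤ 1
    rw [div_mul_eq_mul_div, div_le_one (by positivity)]
    have h1 : acc * M ≤ M ^ 2 := by nlinarith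
    nlinarith
  have hgap : D.runExpect p (fun ω : Fin T → IterSample S A =>
      D.gap q M (D.output p ω).1 (D.output p ω).2) ≤ acc := by
    have h1 := hadm.runExpect_gap_le hT0
    have h2 := gap_bound_le hM1 hN2 (Nat.cast_le.2 D.card_le_numPairs) hacc0 hacc1 hlog hTX
    subst hp
    exact h1.trans h2
  refine ⟨hgap, fun ω => existsUnique_isDecomposition (D.output_snd_pos p hT0 ω)
    (D.output_snd_mem p hT0 ω).2, fun lam π hd => ?_, fun ω => ?_⟩
  · have : Nonempty (Policy S A) := ⟨fun i => Classical.arbitrary _⟩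
    rw [sub_le_iff_le_add]
    refine ciSup_le fun π' => ?_
    have h1 : ∀ ω : Fin T → IterSample S A, D.value q π' +
        -M * D.gap q M (D.output p ω).1 (D.output p ω).2 ≤ D.value q (π ω) := fun ω => by
      have hbox : (D.output p ω).1 ∈ box S (2 * M) := by
        have := hadm.output_fst_mem hT0 ω
        rw [hp] at this ⊢
        exact this
      linarith [D.value_sub_value_le q hM hbox (D.output_snd_mem p hT0 ω) (hd ω) π']
    have h2 := D.runExpect_mono p h1
    rw [D.runExpect_const_add_mul] at h2
    have h3 := mul_le_mul_of_nonneg_left hgap (by linarith : 0 ≤ M)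
    have h4 : M * acc = ε / 3 := by
      rw [hM, hacc]
      field_simp
    linarith
  · have h1 : (T : ℝ) ≤ 10000 * X + 1 := by
      rw [hT]
      exact (Nat.ceil_lt_add_one (by positivity)).le
    have h2 : X = 9 * ((1 - D.γ) ^ (-4 : ℤ) * D.numPairs * ε ^ (-2 : ℤ) *
        Real.log D.numPairs) := by
      rw [hX, hM, hacc, zpow_neg, zpow_neg]
      norm_cast
      field_simp
      norm_num
    rw [sampleCount_eq]
    push_cast
    linarith
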